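/- **Setting.** Let $\mathcal G$ be a connected undirected graph on $\{1,\dots,m\}$ with gossip matrix $L\in\mathbb R^{m\times m}$, i.e. $L=L^T\succeq 0$, $\operatorname{Null}(L)=\operatorname{Span}\{\mathbf 1_m\}$ and $L_{ij}\ne 0$ only if $i=j$ or $(i,j)$ is an edge. Let $W=L\otimes I_n$ and $B=\begin{pmatrix}I_{mn}\\W\end{pmatrix}$. For $i=1,\dots,m$ let $f_i:\mathbb R^n\to\mathbb R$ be differentiable, $\mu_i$-strongly convex ($\mu_i>0$) with $L_i$-Lipschitz gradient, and let $g_i:\mathbb R^n\to\overline{\mathbb R}$ be closed proper convex. Put $\mu=\min_i\mu_i$, $F(x)=\sum_{i=1}^m f_i(x_i)$ for $x\in\mathbb R^{mn}$, and for $y\in\mathbb R^{2mn}$ put $G(y)=\sum_{i=1}^m g_i(y_i)$ if $y_{m+1}=\dots=y_{2m}=0$ and $G(y)=+\infty$ otherwise. Consider $$\text{(P)}\quad \min_{x,y}\ F(x)+G(y)\quad\text{s.t. } Bx=y ,$$ its Lagrangian $l(x,y;\lambda)=F(x)+G(y)-\langle\lambda,Bx-y\rangle$, and its dual $\min_\lambda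 H(\lambda):=F^*(B^T\lambda)+G^*(-\lambda)$, with set of minimizers $\Omega\subseteq\mathbb R^{2mn}$. Let $\mathcal T_H=\partial H$ and $\mathcal T_l(x,y,\lambda)=\{(x',y',\lambda')\mid (x',y',-\lambda')\in\partial l(x,y;\lambda)\}$, where $\partial l$ is the convex-concave subdifferential. All norms are Euclidean, and the distance to the empty set is $+\infty$. A multivalued mapping $\mathcal F$ satisfies the *error bound condition* at $\bar v$ with modulus $\kappa\ge0$ if $\mathcal F^{-1}(\bar v)\neq\emptyset$ and for some $\varepsilon>0$, $\operatorname{dist}(u,\mathcal F^{-1}(\bar v))\le\kappa\operatorname{dist}(\bar v,\mathcal F(u))$ whenever $\operatorname{dist}(\bar v,\mathcal F(u))\le\varepsilon$. It is *metrically subregular* at $\bar u$ for $\bar v\in\mathcal F(\bar u)$ with modulus $\kappa\ge0$ if there are neighborhoods $U$ of $\bar u$ and $V$ of $\bar v$ with $\operatorname{dist}(u,\mathcal F^{-1}(\bar v))\le\kappa\operatorname{dist}(\bar v,\mathcal F(u)\cap V)$ for all $u\in U$ such that $\mathcal F(u)\cap V\ne\emptyset$. **Algorithm (ALM).** Let $\sigma_k>0$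 with $\sigma_k\to\sigma_\infty\in(0,+\infty]$, $(x^0,y^0,\lambda^0)\in\operatorname{int}(\operatorname{dom}F)\times\operatorname{dom}G\times\mathbb R^{2mn}$, and let $\phi_k(x)=\min_y\{F(x)+G(y)+\frac{\sigma_k}2\|Bx-y-\frac1{\sigma_k}\lambda^k\|^2-\frac1{2\sigma_k}\|\lambda^k\|^2\}$. For $k=0,1,\dots$, the iterate $x^{k+1}$ is an approximate minimizer of $\phi_k$ (in the sense of the stopping criteria below), $y^{k+1}=\operatorname{Prox}_{\frac1{\sigma_k}G}(Bx^{k+1}-\frac1{\sigma_k}\lambda^k)$ and $\lambda^{k+1}=\lambda^k-\sigma_k(Bx^{k+1}-y^{k+1})$. The criteria, required for all $k$, are - (A′) $\|\nabla\phi_k(x^{k+1})\|^2\le\epsilon_k^2\mu/\sigma_k$, where $\epsilon_k\ge0$, $\sum_k\epsilon_k<\infty$; - (B′) $\|\nabla\phi_k(x^{k+1})\|^2\le(\delta_k^2\mu/\sigma_k)\|\lambda^{k+1}-\lambda^k\|^2$, where $\delta_k\ge0$, $\sum_k\delta_k<\infty$; - (C′) $\|\nabla\phi_k(x^{k+1})\|\le(\delta_k'/\sigma_k)\|\lambda^{k+1}-\lambda^k\|$,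 where $0\le\delta'_k\to0$. **Theorem (convergence rate of ALM).** Suppose that (P) has an optimal solution and that $\mathcal T_H$ satisfies the error bound condition at $0$ with modulus $a_H$. Let $\{(x^k,y^k,\lambda^k)\}$ be any infinite sequence generated by ALM with criteria (A′) and (B′). Then $\{\lambda^k\}$ converges to some $\lambda^*\in\Omega$, and for all sufficiently large $k$ $$\operatorname{dist}(\lambda^{k+1},\Omega)\le\theta_k\operatorname{dist}(\lambda^k,\Omega),\qquad \theta_k=\frac{a_H(a_H^2+\sigma_k^2)^{-1/2}+2\delta_k}{1-\delta_k},$$ where $\theta_k\to\theta_\infty=a_H(a_H^2+\sigma_\infty^2)^{-1/2}<1$ ($\theta_\infty=0$ if $\sigma_\infty=+\infty$). Moreover, (P) has a unique optimal solution $(x^*,y^*)$, it lies in $\operatorname{int}(\operatorname{dom}F)\times\operatorname{dom}G$, and $(x^k,y^k)\to(x^*,y^*)$. If in addition $\mathcal T_l$ is metrically subregular at $(x^*,y^*,\lambda^*)$ for the origin with modulus $a_l$ and criterion (C′) is also used, then for all sufficiently large $k$ $$\|(x^{k+1},y^{k+1})-(x^*,y^*)\|\le\theta_k'\,\|\lambda^{k+1}-\lambda^k\|,\qquad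 \theta_k'=\frac{a_l(1+\delta_k')}{\sigma_k},$$ and $\theta_k'\to a_l/\sigma_\infty$ ($=0$ if $\sigma_\infty=+\infty$). -/

import Mathlib

open Filter Topology

noncomputable section

namespace DistALM

/-! ### Convex analysis for extended-real-valued functions -/

section General

variable {E : Type*} [NormedAddCommGroup E] [InnerProductSpace ℝ E]

/-- The effective domain `dom p`. -/
def effDom (p : E → EReal) : Set E := {x | p x < ⊤}

/-- Closed proper convex functions with values in the extended reals. -/
structure ClosedProperConvex (p : E → EReal) : Prop where
  ne_bot : ∀ x, p x ≠ ⊥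
  dom_nonempty : (effDom p).Nonempty
  closed : LowerSemicontinuous p
  convex : Convex ℝ {q : E × ℝ | p q.1 ≤ (q.2 : EReal)}

/-- The conjugate `p* v = sup_x (⟨x, v⟩ - p x)`.
For a proper `p`, points outside `dom p` contribute `⊥` to the supremum. -/
def conj (p : E → EReal) (v : E) : EReal := ⨆ x, (((inner ℝ x v : ℝ) : EReal) - p x)

/-- The convex subdifferential `∂p x`. It is empty at points outside `dom p` when `p` is proper. -/
def subdiff (p : E → EReal) (x : E) : Set E :=
  {v | ∀ z, p x + ((inner ℝ v (z - x) : ℝ) : EReal) ≤ p z}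

/-- The set `argmin_y { p y + ‖y - x‖² / 2 }`, which is the singleton `{Prox_p x}` if `p` is closed
proper convex. -/
def proxSet (p : E → EReal) (x : E) : Set E :=
  {y | ∀ z, p y + ((1 / 2 * ‖y - x‖ ^ 2 : ℝ) : EReal) ≤ p z + ((1 / 2 * ‖z - x‖ ^ 2 : ℝ) : EReal)}

/-- A differentiable function is `μ`-strongly convex. -/
def StronglyConvex [CompleteSpace E] (f : E → ℝ) (μ : ℝ) : Prop :=
  0 < μ ∧ Differentiable ℝ f ∧
    ∀ x y, f x + inner ℝ (gradient f x) (y - x) + 1 / 2 * μ * ‖y - x‖ ^ 2 ≤ f y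

/-- `f` is `L`-smooth on the whole space. -/
def LSmooth [CompleteSpace E] (f : E → ℝ) (L : ℝ) : Prop :=
  0 ≤ L ∧ Differentiable ℝ f ∧ ∀ x y, ‖gradient f x - gradient f y‖ ≤ L * ‖x - y‖

/-- The subdifferential of a convex-concave function `l`: subgradients in the first (convex)
variable paired with supergradients in the second (concave) variable. -/
def saddleSubdiff {P D : Type*} [NormedAddCommGroup P] [InnerProductSpace ℝ P]
    [NormedAddCommGroup D] [InnerProductSpace ℝ D]
    (l : P → D → EReal) (z : WithLp 2 (P × D)) : Set (WithLp 2 (P × D)) :=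
  {w | w.fst ∈ subdiff (fun q => l q z.snd) z.fst ∧
    ∀ ν, l z.fst ν ≤ l z.fst z.snd + ((inner ℝ w.snd (ν - z.snd) : ℝ) : EReal)}

end General

/-! ### Multivalued mappings -/

section Multi

variable {X Y : Type*} [PseudoMetricSpace X] [PseudoMetricSpace Y]

/-- The inverse image `T⁻¹(y)` of a multivalued mapping. -/
def invImage (T : X → Set Y) (y : Y) : Set X := {x | y ∈ T x}

/-- The error bound condition for `T` at `y` with modulus `κ`. The distance to an empty set is `+∞`,
so only points with `T x` nonempty are concerned. -/
def ErrorBound (T : X → Set Y) (y : Y) (κ : ℝ) : Prop :=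
  0 ≤ κ ∧ (invImage T y).Nonempty ∧
    ∃ ε > 0, ∀ x, (T x).Nonempty → Metric.infDist y (T x) ≤ ε →
      Metric.infDist x (invImage T y) ≤ κ * Metric.infDist y (T x)

/-- Metric subregularity of `T` at `xbar` for `ybar` with modulus `κ`. The distance to an empty set
is `+∞`, so only points with `T x ∩ V` nonempty are concerned. -/
def MetricallySubregular (T : X → Set Y) (xbar : X) (ybar : Y) (κ : ℝ) : Prop :=
  0 ≤ κ ∧ ybar ∈ T xbar ∧
    ∃ U ∈ 𝓝 xbar, ∃ V ∈ 𝓝 ybar, ∀ x ∈ U, (T x ∩ V).Nonempty →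
      Metric.infDist x (invImage T ybar) ≤ κ * Metric.infDist ybar (T x ∩ V)

end Multi

/-! ### The distributed problem -/

/-- `L` is a gossip matrix of the graph `Gr`. -/
structure IsGossip {m : ℕ} (Gr : SimpleGraph (Fin m)) (L : Matrix (Fin m) (Fin m) ℝ) : Prop where
  symm : L.IsSymm
  posSemidef : L.PosSemidef
  ker_eq : LinearMap.ker L.mulVecLin = Submodule.span ℝ {fun _ => (1 : ℝ)}
  graph_induced : ∀ i j, L i j ≠ 0 → i = j ∨ Gr.Adj i j

/-- The local space `ℝⁿ`. -/
abbrev Loc (n : ℕ) : Type := EuclideanSpace ℝ (Fin n)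

/-- The space `ℝ^{mn}` of stacked vectors `(x₁, …, xₘ)`, with the Euclidean norm. -/
abbrev XSp (m n : ℕ) : Type := PiLp 2 (fun _ : Fin m => Loc n)

/-- The space `ℝ^{2mn}` of stacked vectors: `Sum.inl i` is block `i`, `Sum.inr i` is block `m + i`;
Euclidean norm. -/
abbrev YSp (m n : ℕ) : Type := PiLp 2 (fun _ : Fin m ⊕ Fin m => Loc n)

/-- The space of pairs `(x, y)`, with the Euclidean norm. -/
abbrev PSp (m n : ℕ) : Type := WithLp 2 (XSp m n × YSp m n)

/-- The space of triples `((x, y), lam)`, with the Euclidean norm. -/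
abbrev ZSp (m n : ℕ) : Type := WithLp 2 (PSp m n × YSp m n)

section Problem

variable {m n : ℕ}

/-- The linear map `B = (I ; W)` with `W = L ⊗ Iₙ`, i.e. `(W x)ᵢ = ∑ⱼ Lᵢⱼ xⱼ`. -/
def opB (n : ℕ) (L : Matrix (Fin m) (Fin m) ℝ) : XSp m n →ₗ[ℝ] YSp m n where
  toFun x := WithLp.toLp 2 (Sum.elim (fun i => x i) (fun i => ∑ j, L i j • x j))
  map_add' x y := by
    ext s : 1
    rcases s with i | i <;> simp [smul_add, Finset.sum_add_distrib]
  map_smul' c x := by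
    ext s : 1
    rcases s with i | i <;> simp [Finset.smul_sum, smul_comm c]

/-- `F x = ∑ᵢ fᵢ(xᵢ)`. -/
def sumF (f : Fin m → Loc n → ℝ) (x : XSp m n) : EReal := ((∑ i, f i (x i) : ℝ) : EReal)

open Classical in
/-- `G y = ∑ᵢ gᵢ(yᵢ)` for vectors `y = (y₁, …, yₘ, 0, …, 0)`, and `+∞` for the other vectors. -/
def sumG (g : Fin m → Loc n → EReal) (y : YSp m n) : EReal :=
  if ∀ i, y (Sum.inr i) = 0 then ∑ i, g i (y (Sum.inl i)) else ⊤

/-- `(x, y)` is an optimal solution of `min F x + G y` subject to `B x = y`. -/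
def IsOptimal (f : Fin m → Loc n → ℝ) (g : Fin m → Loc n → EReal)
    (L : Matrix (Fin m) (Fin m) ℝ) (x : XSp m n) (y : YSp m n) : Prop :=
  opB n L x = y ∧ sumF f x + sumG g y < ⊤ ∧
    ∀ x' y', opB n L x' = y' → sumF f x + sumG g y ≤ sumF f x' + sumG g y'

/-- The Lagrangian `l(x, y; lam) = F x + G y - ⟨lam, B x - y⟩`. -/
def lagrangian (f : Fin m → Loc n → ℝ) (g : Fin m → Loc n → EReal)
    (L : Matrix (Fin m) (Fin m) ℝ) (p : PSp m n) (lam : YSp m n) : EReal :=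
  sumF f p.fst + sumG g p.snd - ((inner ℝ lam (opB n L p.fst - p.snd) : ℝ) : EReal)

/-- The dual objective `H lam = F*(Bᵀ lam) + G*(-lam)`. -/
def dualH (f : Fin m → Loc n → ℝ) (g : Fin m → Loc n → EReal)
    (L : Matrix (Fin m) (Fin m) ℝ) (lam : YSp m n) : EReal :=
  conj (sumF f) (LinearMap.adjoint (opB n L) lam) + conj (sumG g) (-lam)

/-- The set `Ω` of optimal dual solutions, i.e. of minimizers of `H`. -/
def dualSol (f : Fin m → Loc n → ℝ) (g : Fin m → Loc n → EReal)
    (L : Matrix (Fin m) (Fin m) ℝ) : Set (YSp m n) :=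
  {lam | ∀ ν, dualH f g L lam ≤ dualH f g L ν}

/-- The operator `T_H = ∂H`. -/
def opTH (f : Fin m → Loc n → ℝ) (g : Fin m → Loc n → EReal)
    (L : Matrix (Fin m) (Fin m) ℝ) : YSp m n → Set (YSp m n) :=
  subdiff (dualH f g L)

/-- The operator `T_l(x, y, lam) = {(x', y', lam') | (x', y', -lam') ∈ ∂l(x, y; lam)}`. -/
def opTl (f : Fin m → Loc n → ℝ) (g : Fin m → Loc n → EReal)
    (L : Matrix (Fin m) (Fin m) ℝ) (z : ZSp m n) : Set (ZSp m n) :=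
  {w | WithLp.toLp 2 (w.fst, -w.snd) ∈ saddleSubdiff (lagrangian f g L) z}

/-! ### The inexact augmented Lagrangian method -/

/-- The augmented Lagrangian
`L_σ(x, y; lam) = F x + G y + σ/2 ‖B x - y - lam/σ‖² - ‖lam‖²/(2σ)`. -/
def augLag (f : Fin m → Loc n → ℝ) (g : Fin m → Loc n → EReal)
    (L : Matrix (Fin m) (Fin m) ℝ) (σ : ℝ) (lam : YSp m n) (x : XSp m n) (y : YSp m n) : EReal :=
  sumF f x + sumG g y +
    ((σ / 2 * ‖opB n L x - y - (1 / σ) • lam‖ ^ 2 - 1 / (2 * σ) * ‖lam‖ ^ 2 : ℝ) : EReal)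

/-- `φ x = min_y L_σ(x, y; lam)` (a finite number for `σ > 0` and closed proper convex `gᵢ`). -/
def phi (f : Fin m → Loc n → ℝ) (g : Fin m → Loc n → EReal)
    (L : Matrix (Fin m) (Fin m) ℝ) (σ : ℝ) (lam : YSp m n) (x : XSp m n) : ℝ :=
  (⨅ y, augLag f g L σ lam x y).toReal

/-- `(x k, y k, lam k)` is generated by the augmented Lagrangian method with penalty
parameters `σ k`; how well `x (k + 1)` has to minimize `φ_k` is prescribed by the stopping
criteria below. -/
structure IsALM (f : Fin m → Loc n → ℝ) (g : Fin m → Loc n → EReal)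
    (L : Matrix (Fin m) (Fin m) ℝ) (σ : ℕ → ℝ)
    (x : ℕ → XSp m n) (y lam : ℕ → YSp m n) : Prop where
  init_x : x 0 ∈ interior (effDom (sumF f))
  init_y : y 0 ∈ effDom (sumG g)
  step_y : ∀ k, y (k + 1) ∈ proxSet (fun v => ((1 / σ k : ℝ) : EReal) * sumG g v)
    (opB n L (x (k + 1)) - (1 / σ k) • lam k)
  step_lam : ∀ k, lam (k + 1) = lam k - σ k • (opB n L (x (k + 1)) - y (k + 1))

/-- Stopping criterion (A′): `‖∇φ_k(x^{k+1})‖² ≤ ε_k² μ / σ_k`, `∑ ε_k < ∞`. -/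
def CritA (f : Fin m → Loc n → ℝ) (g : Fin m → Loc n → EReal)
    (L : Matrix (Fin m) (Fin m) ℝ) (μ : ℝ) (σ : ℕ → ℝ)
    (x : ℕ → XSp m n) (lam : ℕ → YSp m n) (ε : ℕ → ℝ) : Prop :=
  (∀ k, 0 ≤ ε k) ∧ Summable ε ∧
    ∀ k, ‖gradient (phi f g L (σ k) (lam k)) (x (k + 1))‖ ^ 2 ≤ ε k ^ 2 * μ / σ k

/-- Stopping criterion (B′): `‖∇φ_k(x^{k+1})‖² ≤ δ_k² μ / σ_k ‖lam^{k+1} - lam^k‖²`,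
`∑ δ_k < ∞`. -/
def CritB (f : Fin m → Loc n → ℝ) (g : Fin m → Loc n → EReal)
    (L : Matrix (Fin m) (Fin m) ℝ) (μ : ℝ) (σ : ℕ → ℝ)
    (x : ℕ → XSp m n) (lam : ℕ → YSp m n) (δ : ℕ → ℝ) : Prop :=
  (∀ k, 0 ≤ δ k) ∧ Summable δ ∧
    ∀ k, ‖gradient (phi f g L (σ k) (lam k)) (x (k + 1))‖ ^ 2 ≤
      δ k ^ 2 * μ / σ k * ‖lam (k + 1) - lam k‖ ^ 2

/-- Stopping criterion (C′): `‖∇φ_k(x^{k+1})‖ ≤ δ'_k / σ_k ‖lam^{k+1} - lam^k‖`,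
`0 ≤ δ'_k → 0`. -/
def CritC (f : Fin m → Loc n → ℝ) (g : Fin m → Loc n → EReal)
    (L : Matrix (Fin m) (Fin m) ℝ) (σ : ℕ → ℝ)
    (x : ℕ → XSp m n) (lam : ℕ → YSp m n) (δ' : ℕ → ℝ) : Prop :=
  (∀ k, 0 ≤ δ' k) ∧ Tendsto δ' atTop (𝓝 0) ∧
    ∀ k, ‖gradient (phi f g L (σ k) (lam k)) (x (k + 1))‖ ≤
      δ' k / σ k * ‖lam (k + 1) - lam k‖

/-- The factor `θ = (a (a² + σ²)^{-1/2} + 2 δ) (1 - δ)⁻¹`. -/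
def theta (a σ δ : ℝ) : ℝ := (a / √(a ^ 2 + σ ^ 2) + 2 * δ) / (1 - δ)

/-- `θ_∞ = a (a² + σ_∞²)^{-1/2}`, which is `0` for `σ_∞ = +∞`. -/
def thetaInf (a : ℝ) (σinf : EReal) : ℝ :=
  if σinf = ⊤ then 0 else a / √(a ^ 2 + σinf.toReal ^ 2)

/-- `a / σ_∞`, which is `0` for `σ_∞ = +∞`. -/
def ratioInf (a : ℝ) (σinf : EReal) : ℝ :=
  if σinf = ⊤ then 0 else a / σinf.toReal

end Problem

end DistALM

end

open DistALM

/-!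
The augmented Lagrangian method is the proximal point method for the dual function
`H lam = F*(Bᵀ lam) + G*(-lam)`, and every estimate below comes from monotonicity of `∇F` and `∂G`.

Call `∇F x - Bᵀ lam` the residual. The optimality condition of the proximal step for `y` reads
`-lam ∈ ∂G y` for the updated multiplier `lam`, and the gradient of `φ_k` at `x` is the residual at
`(x, lam)` (`IsProx.hasGradientAt_augFun`, by differentiating the Moreau envelope of `G`). So the
stopping criteria bound the residual of an iterate. Adding the monotonicity inequalities for two
points with `-lam ∈ ∂G y` and `-lam' ∈ ∂G y'` gives `residual_monotone`, which is used three times.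

* Against a primal-dual solution it yields the Fejér inequality `MultiplierStep.fejer`, with an
  error that (A′) makes summable.
* Against the step with exact minimization in `x`, which exists as `φ_k` is strongly convex, it
  bounds the distance from `lam^{k+1}` to the exact multiplier `p` by `ε_k`, and by
  `δ_k ‖lam^{k+1} - lam^k‖` (`MultiplierStep.norm_sub_exact_sq_le`). The exact multiplier satisfies
  `(lam^k - p) / σ_k ∈ ∂H p`, which is where the error bound condition applies.
* Between two primal-dual solutions it shows that the primal part is unique.

If `d = dist(lam^k, Ω)`, the Fejér inequality `dist(p, Ω)² + ‖p - lam^k‖² ≤ d²` and the error bound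
`dist(p, Ω) ≤ (a/σ_k) ‖p - lam^k‖` give `dist(p, Ω) ≤ a (a² + σ_k²)^{-1/2} d`; the passage from `p`
to `lam^{k+1}` costs the terms with `δ_k`. The conjugates enter only through the easy half of
Fenchel duality (`sub_mem_subdiff_dualFun`): that a minimizer of `H` extends to a primal-dual solution
follows since an exact step that starts at the minimizer does not move
(`exists_of_mem_dualMinimizers`). No constraint qualification is needed, as `F*` is finite
everywhere.

For the primal rate, the residual and the infeasibility of an iterate form an element of `T_l` of
norm at most `(1 + δ'_k) / σ_k ‖lam^{k+1} - lam^k‖`, while all points of `T_l⁻¹(0)` have the same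
primal part.
-/

namespace DistALM

/-! ### Closed proper convex functions and proximal points -/

theorem eq_top_of_notMem_effDom {X : Type*} {p : X → EReal} {x : X} (hx : x ∉ effDom p) :
    p x = ⊤ :=
  not_lt_top_iff.1 hx

section Prox

variable {E : Type*} [NormedAddCommGroup E] {p : E → EReal}

/-- `y` minimizes `p + σ/2 ‖· - w‖²`, i.e. `y` is the proximal point of `w` for `p / σ`. The
minimization is written over `dom p`, where `p` is real-valued. -/
def IsProx (p : E → EReal) (σ : ℝ) (w y : E) : Prop :=
  y ∈ effDom p ∧ ∀ z ∈ effDom p,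
    (p y).toReal + σ / 2 * ‖y - w‖ ^ 2 ≤ (p z).toReal + σ / 2 * ‖z - w‖ ^ 2

/-- The Moreau envelope `w ↦ min_y {p y + σ/2 ‖y - w‖²}`. -/
noncomputable def moreauEnv (p : E → EReal) (σ : ℝ) (w : E) : ℝ :=
  ⨅ y : effDom p, ((p y).toReal + σ / 2 * ‖(y : E) - w‖ ^ 2)

theorem IsProx.moreauEnv_eq {σ : ℝ} {w y : E} (h : IsProx p σ w y) :
    moreauEnv p σ w = (p y).toReal + σ / 2 * ‖y - w‖ ^ 2 :=
  IsLeast.csInf_eq ⟨⟨⟨y, h.1⟩, rfl⟩, by rintro _ ⟨z, rfl⟩; exact h.2 z z.2⟩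

end Prox

section Convex

variable {E : Type*} [NormedAddCommGroup E] [InnerProductSpace ℝ E] {p : E → EReal}

theorem ClosedProperConvex.coe_toReal (hp : ClosedProperConvex p) {x : E} (hx : x ∈ effDom p) :
    ((p x).toReal : EReal) = p x :=
  EReal.coe_toReal (ne_of_lt hx) (hp.ne_bot x)

theorem ClosedProperConvex.mem_subdiff_iff (hp : ClosedProperConvex p) {x v : E} :
    v ∈ subdiff p x ↔ x ∈ effDom p ∧
      ∀ z ∈ effDom p, (p x).toReal + inner ℝ v (z - x) ≤ (p z).toReal := by
  constructor
  · intro h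
    have hx : x ∈ effDom p := by
      obtain ⟨z, hz⟩ := hp.dom_nonempty
      by_contra hx
      have h1 := h z
      rw [eq_top_of_notMem_effDom hx, EReal.top_add_coe] at h1
      exact absurd hz (not_lt.2 h1)
    refine ⟨hx, fun z hz => ?_⟩
    have h1 := h z
    rw [← hp.coe_toReal hx, ← hp.coe_toReal hz] at h1
    exact_mod_cast h1
  · rintro ⟨hx, h⟩ z
    by_cases hz : z ∈ effDom p
    · rw [← hp.coe_toReal hx, ← hp.coe_toReal hz]
      exact_mod_cast h z hz
    · rw [eq_top_of_notMem_effDom hz]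
      exact le_top

theorem ClosedProperConvex.segment_le (hp : ClosedProperConvex p) {x z : E} (hx : x ∈ effDom p)
    (hz : z ∈ effDom p) {t : ℝ} (ht0 : 0 ≤ t) (ht1 : t ≤ 1) :
    x + t • (z - x) ∈ effDom p ∧
      (p (x + t • (z - x))).toReal ≤ (p x).toReal + t * ((p z).toReal - (p x).toReal) := by
  have h := hp.convex (x := (x, (p x).toReal)) (y := (z, (p z).toReal))
    (hp.coe_toReal hx).ge (hp.coe_toReal hz).ge (sub_nonneg.2 ht1) ht0 (by ring)
  have e : (1 - t) • x + t • z = x + t • (z - x) := by module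
  simp only [Set.mem_ofPred_eq, Prod.smul_mk, Prod.mk_add_mk, e, smul_eq_mul] at h
  have hd : x + t • (z - x) ∈ effDom p := lt_of_le_of_lt h (EReal.coe_lt_top _)
  refine ⟨hd, ?_⟩
  rw [← hp.coe_toReal hd] at h
  have := EReal.coe_le_coe_iff.1 h
  linarith

theorem isClosed_subdiff (hp : ClosedProperConvex p) (x : E) : IsClosed (subdiff p x) := by
  by_cases hx : x ∈ effDom p
  · have : subdiff p x =
        ⋂ z ∈ effDom p, {v | (p x).toReal + inner ℝ v (z - x) ≤ (p z).toReal} := by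
      ext v
      simp [hp.mem_subdiff_iff, hx]
    rw [this]
    exact isClosed_biInter fun z _ => isClosed_le (by fun_prop) (by fun_prop)
  · have : subdiff p x = ∅ := by
      ext v
      simp [hp.mem_subdiff_iff, hx]
    simp [this]

/-- The subdifferential is a monotone operator. -/
theorem inner_subdiff_nonneg (hp : ClosedProperConvex p) {x x' v v' : E}
    (h : v ∈ subdiff p x) (h' : v' ∈ subdiff p x') : 0 ≤ inner ℝ (v - v') (x - x') := by
  rw [hp.mem_subdiff_iff] at h h'
  have h1 := h.2 x' h'.1
  have h2 := h'.2 x h.1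
  have h3 : inner ℝ v (x' - x) = - inner ℝ v (x - x') := by
    rw [← inner_neg_right, neg_sub]
  rw [inner_sub_left]
  linarith

theorem invImage_subdiff_zero {p : E → EReal} :
    invImage (subdiff p) 0 = {x | ∀ z, p x ≤ p z} := by
  ext x
  simp [invImage, subdiff]

/-- A minimum over a unit ball bounds a convex function below by a function with linear decay,
which makes `p + σ/2 ‖· - w‖²` coercive. -/
theorem ClosedProperConvex.exists_isProx [ProperSpace E] (hp : ClosedProperConvex p) {σ : ℝ}
    (hσ : 0 < σ) (w : E) : ∃ y, IsProx p σ w y := by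
  obtain ⟨x₀, hx₀⟩ := hp.dom_nonempty
  obtain ⟨z₁, hz₁, hmin⟩ := (hp.closed.lowerSemicontinuousOn _).exists_isMinOn
    ⟨x₀, Metric.mem_closedBall_self zero_le_one⟩ (isCompact_closedBall x₀ (1 : ℝ))
  have hmin' : ∀ z ∈ Metric.closedBall x₀ 1, p z₁ ≤ p z := fun z hz => hmin hz
  have hz₁d : z₁ ∈ effDom p :=
    lt_of_le_of_lt (hmin' x₀ (Metric.mem_closedBall_self zero_le_one)) hx₀
  have hball : ∀ z ∈ effDom p, ‖z - x₀‖ ≤ 1 → (p z₁).toReal ≤ (p z).toReal := by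
    intro z hz h
    have := hmin' z (by rwa [mem_closedBall_iff_norm])
    rw [← hp.coe_toReal hz, ← hp.coe_toReal hz₁d] at this
    exact_mod_cast this
  set D : ℝ := (p x₀).toReal - (p z₁).toReal with hD
  have hD0 : 0 ≤ D := sub_nonneg.2 (hball x₀ hx₀ (by simp))
  have hlin : ∀ z ∈ effDom p, 1 ≤ ‖z - x₀‖ →
      (p x₀).toReal - ‖z - x₀‖ * D ≤ (p z).toReal := by
    intro z hz h
    have hr : 0 < ‖z - x₀‖ := lt_of_lt_of_le one_pos h
    obtain ⟨h1, h2⟩ := hp.segment_le hx₀ hz (inv_nonneg.2 hr.le) (inv_le_one_of_one_le₀ h)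
    have h3 := hball _ h1 (by
      rw [add_sub_cancel_left, norm_smul, Real.norm_of_nonneg (inv_nonneg.2 hr.le),
        inv_mul_cancel₀ hr.ne'])
    have h4 : -D ≤ ‖z - x₀‖⁻¹ * ((p z).toReal - (p x₀).toReal) := by linarith
    have h5 := mul_le_mul_of_nonneg_left h4 hr.le
    rw [mul_inv_cancel_left₀ hr.ne'] at h5
    linarith
  set c : ℝ := ‖x₀ - w‖ with hc
  set R : ℝ := 2 * c + 4 * D / σ + 1 with hR
  have hc0 : 0 ≤ c := norm_nonneg _
  have hR1 : 1 ≤ R := by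
    have : 0 ≤ 4 * D / σ := by positivity
    linarith
  have hfar : ∀ z ∈ effDom p, R ≤ ‖z - x₀‖ →
      (p x₀).toReal + σ / 2 * ‖x₀ - w‖ ^ 2 ≤ (p z).toReal + σ / 2 * ‖z - w‖ ^ 2 := by
    intro z hz h
    have h1 := hlin z hz (hR1.trans h)
    set r := ‖z - x₀‖ with hr
    have h2 : r ^ 2 - 2 * (r * c) + c ^ 2 ≤ ‖z - w‖ ^ 2 := by
      have e : z - w = (z - x₀) + (x₀ - w) := by abel
      rw [e, norm_add_sq_real]
      have := neg_le_of_abs_le (abs_real_inner_le_norm (z - x₀) (x₀ - w))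
      linarith
    have h3 : 2 * D ≤ σ / 2 * (r - 2 * c) := by
      have h4 : 4 * D / σ ≤ r - 2 * c := by linarith
      rw [div_le_iff₀ hσ] at h4
      linarith
    have h5 : r * (2 * D) ≤ r * (σ / 2 * (r - 2 * c)) :=
      mul_le_mul_of_nonneg_left h3 (norm_nonneg _)
    have h6 : σ / 2 * (r ^ 2 - 2 * (r * c) + c ^ 2) ≤ σ / 2 * ‖z - w‖ ^ 2 :=
      mul_le_mul_of_nonneg_left h2 (by positivity)
    have h7 : 0 ≤ r * D := mul_nonneg (norm_nonneg _) hD0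
    nlinarith
  have hlsc : LowerSemicontinuous fun z => p z + ((σ / 2 * ‖z - w‖ ^ 2 : ℝ) : EReal) := by
    refine hp.closed.add' (g := fun z => ((σ / 2 * ‖z - w‖ ^ 2 : ℝ) : EReal)) ?_ fun z => ?_
    · exact (continuous_coe_real_ereal.comp (by fun_prop)).lowerSemicontinuous
    · exact EReal.continuousAt_add (.inr (EReal.coe_ne_bot _)) (.inr (EReal.coe_ne_top _))
  have hmem₀ : x₀ ∈ Metric.closedBall x₀ R := Metric.mem_closedBall_self (by linarith)
  obtain ⟨y, hy, hymin⟩ := (hlsc.lowerSemicontinuousOn _).exists_isMinOn ⟨x₀, hmem₀⟩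
    (isCompact_closedBall x₀ R)
  have hymin' : ∀ z ∈ Metric.closedBall x₀ R, p y + ((σ / 2 * ‖y - w‖ ^ 2 : ℝ) : EReal) ≤
      p z + ((σ / 2 * ‖z - w‖ ^ 2 : ℝ) : EReal) := fun z hz => hymin hz
  have hyd : y ∈ effDom p := by
    by_contra hyd
    have h1 := hymin' x₀ hmem₀
    rw [eq_top_of_notMem_effDom hyd, EReal.top_add_coe, ← hp.coe_toReal hx₀,
      ← EReal.coe_add] at h1
    exact EReal.coe_ne_top _ (top_le_iff.1 h1)
  have hreal : ∀ z ∈ effDom p, z ∈ Metric.closedBall x₀ R →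
      (p y).toReal + σ / 2 * ‖y - w‖ ^ 2 ≤ (p z).toReal + σ / 2 * ‖z - w‖ ^ 2 := by
    intro z hz hzR
    have h1 := hymin' z hzR
    rw [← hp.coe_toReal hz, ← hp.coe_toReal hyd] at h1
    exact_mod_cast h1
  refine ⟨y, hyd, fun z hz => ?_⟩
  by_cases hzR : z ∈ Metric.closedBall x₀ R
  · exact hreal z hz hzR
  · rw [mem_closedBall_iff_norm, not_le] at hzR
    exact (hreal x₀ hx₀ hmem₀).trans (hfar z hz hzR.le)

/-- The optimality condition `σ (w - y) ∈ ∂p y` of the proximal point `y` of `w`. -/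
theorem IsProx.smul_sub_mem_subdiff (hp : ClosedProperConvex p) {σ : ℝ} {w y : E}
    (h : IsProx p σ w y) : σ • (w - y) ∈ subdiff p y := by
  rw [hp.mem_subdiff_iff]
  refine ⟨h.1, fun z hz => ?_⟩
  -- compare `y` with `y + t (z - y)`, divide by `t` and let `t` tend to `0`
  have key : ∀ t ∈ Set.Ioc (0 : ℝ) 1,
      0 ≤ ((p z).toReal - (p y).toReal - inner ℝ (σ • (w - y)) (z - y)) +
        t * (σ / 2 * ‖z - y‖ ^ 2) := by
    rintro t ⟨ht0, ht1⟩
    obtain ⟨h1, h2⟩ := hp.segment_le h.1 hz ht0.le ht1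
    have h3 := h.2 _ h1
    have e : y + t • (z - y) - w = (y - w) + t • (z - y) := by abel
    have e2 : inner ℝ (σ • (w - y)) (z - y) = - (σ * inner ℝ (y - w) (z - y)) := by
      rw [← neg_sub y w, smul_neg, inner_neg_left, real_inner_smul_left]
    rw [e, norm_add_sq_real, real_inner_smul_right, norm_smul, Real.norm_of_nonneg ht0.le,
      mul_pow] at h3
    rw [e2]
    refine nonneg_of_mul_nonneg_right ?_ ht0
    nlinarith
  have hlim : Tendsto (fun t : ℝ => ((p z).toReal - (p y).toReal -
      inner ℝ (σ • (w - y)) (z - y)) + t * (σ / 2 * ‖z - y‖ ^ 2)) (𝓝[>] 0)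
      (𝓝 (((p z).toReal - (p y).toReal - inner ℝ (σ • (w - y)) (z - y)) +
        0 * (σ / 2 * ‖z - y‖ ^ 2))) :=
    (Continuous.tendsto (by fun_prop) 0).mono_left nhdsWithin_le_nhds
  have := ge_of_tendsto hlim
    (Filter.eventually_of_mem (Ioc_mem_nhdsGT one_pos) key)
  linarith

theorem isProx_of_mem_proxSet (hp : ClosedProperConvex p) {σ : ℝ} (hσ : 0 < σ) {w y : E}
    (h : y ∈ proxSet (fun v => ((1 / σ : ℝ) : EReal) * p v) w) : IsProx p σ w y := by
  have hyd : y ∈ effDom p := by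
    by_contra hyd
    obtain ⟨x₀, hx₀⟩ := hp.dom_nonempty
    have h1 := h x₀
    simp only [eq_top_of_notMem_effDom hyd] at h1
    rw [EReal.coe_mul_top_of_pos (by positivity), EReal.top_add_coe, ← hp.coe_toReal hx₀,
      ← EReal.coe_mul, ← EReal.coe_add] at h1
    exact EReal.coe_ne_top _ (top_le_iff.1 h1)
  refine ⟨hyd, fun z hz => ?_⟩
  have h1 := h z
  beta_reduce at h1
  rw [← hp.coe_toReal hz, ← hp.coe_toReal hyd] at h1
  have h2 : 1 / σ * (p y).toReal + 1 / 2 * ‖y - w‖ ^ 2 ≤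
      1 / σ * (p z).toReal + 1 / 2 * ‖z - w‖ ^ 2 := by exact_mod_cast h1
  have h3 := mul_le_mul_of_nonneg_left h2 hσ.le
  have h4 : ∀ s : ℝ, σ * (1 / σ * s) = s := fun s => by field_simp
  rw [mul_add, mul_add, h4, h4] at h3
  linarith

/-- Upper half of the differentiability of the envelope, with `σ (w - y)` as its gradient at `w`. -/
theorem IsProx.moreauEnv_le [ProperSpace E] (hp : ClosedProperConvex p) {σ : ℝ} (hσ : 0 < σ)
    {w y : E} (h : IsProx p σ w y) (w' : E) :
    moreauEnv p σ w' ≤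
      moreauEnv p σ w + inner ℝ (σ • (w - y)) (w' - w) + σ / 2 * ‖w' - w‖ ^ 2 := by
  obtain ⟨y', h'⟩ := hp.exists_isProx hσ w'
  have h1 := h'.2 y h.1
  have e : y - w' = (y - w) - (w' - w) := by abel
  have e2 : inner ℝ (σ • (w - y)) (w' - w) = - (σ * inner ℝ (y - w) (w' - w)) := by
    rw [← neg_sub y w, smul_neg, inner_neg_left, real_inner_smul_left]
  rw [e, norm_sub_sq_real (y - w)] at h1
  rw [h.moreauEnv_eq, h'.moreauEnv_eq, e2]
  linarith

/-- Lower half of the differentiability of the envelope: it is convex, and `σ (w - y)` is a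
subgradient at `w`. -/
theorem IsProx.le_moreauEnv [ProperSpace E] (hp : ClosedProperConvex p) {σ : ℝ} (hσ : 0 < σ)
    {w y : E} (h : IsProx p σ w y) (w' : E) :
    moreauEnv p σ w + inner ℝ (σ • (w - y)) (w' - w) ≤ moreauEnv p σ w' := by
  obtain ⟨y', h'⟩ := hp.exists_isProx hσ w'
  have h1 := ((hp.mem_subdiff_iff).1 (h.smul_sub_mem_subdiff hp)).2 y' h'.1
  rw [h.moreauEnv_eq, h'.moreauEnv_eq]
  -- with `u = y - w` and `u' = y' - w'` the claim is `0 ≤ ‖u' - u‖²`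
  have e : y' - y = (w' - w) + ((y' - w') - (y - w)) := by abel
  have e2 : ∀ v, inner ℝ (σ • (w - y)) v = - (σ * inner ℝ (y - w) v) := fun v => by
    rw [← neg_sub y w, smul_neg, inner_neg_left, real_inner_smul_left]
  rw [e, e2, inner_add_right, inner_sub_right _ (y' - w') (y - w),
    real_inner_self_eq_norm_sq] at h1
  rw [e2]
  have h2 := norm_sub_sq_real (y' - w') (y - w)
  rw [real_inner_comm] at h2
  have h3 : 0 ≤ σ / 2 * ‖(y' - w') - (y - w)‖ ^ 2 := by positivity
  rw [h2] at h3
  linarith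

end Convex

/-! ### Strongly convex functions -/

section Smooth

variable {E : Type*} [NormedAddCommGroup E] [InnerProductSpace ℝ E] [CompleteSpace E]

/-- A function between an affine function and a parabola that touch at `x` is differentiable
there. -/
theorem hasGradientAt_of_sq_bound {φ : E → ℝ} {x v : E} {C : ℝ}
    (hl : ∀ x', φ x + inner ℝ v (x' - x) ≤ φ x')
    (hu : ∀ x', φ x' ≤ φ x + inner ℝ v (x' - x) + C * ‖x' - x‖ ^ 2) : HasGradientAt φ v x := by
  rw [hasGradientAt_iff_isLittleO]
  have h1 : (fun x' => φ x' - φ x - inner ℝ v (x' - x)) =O[𝓝 x] fun x' => ‖x' - x‖ ^ 2 := by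
    refine Asymptotics.IsBigO.of_bound C (Eventually.of_forall fun x' => ?_)
    have := hl x'
    have := hu x'
    rw [Real.norm_of_nonneg (by linarith), Real.norm_of_nonneg (by positivity)]
    linarith
  refine h1.trans_isLittleO ?_
  have h2 : Tendsto (fun x' : E => x' - x) (𝓝 x) (𝓝 0) := by
    have : Continuous fun x' : E => x' - x := by fun_prop
    simpa using this.tendsto x
  exact ((Asymptotics.isLittleO_norm_pow_id (E' := E) one_lt_two).comp_tendsto h2)

theorem hasGradientAt_add {φ ψ : E → ℝ} {x v w : E} (h : HasGradientAt φ v x)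
    (h' : HasGradientAt ψ w x) : HasGradientAt (fun z => φ z + ψ z) (v + w) x := by
  rw [hasGradientAt_iff_hasFDerivAt] at h h' ⊢
  rw [map_add]
  exact h.add h'

theorem StronglyConvex.exists_gradient_eq_zero [ProperSpace E] {φ : E → ℝ} {μ : ℝ}
    (hφ : StronglyConvex φ μ) : ∃ x, gradient φ x = 0 := by
  obtain ⟨hμ, hd, hle⟩ := hφ
  have hcoer : Tendsto φ (cocompact E) atTop := by
    have h1 : ∀ y, φ 0 + ‖y‖ * (1 / 2 * μ * ‖y‖ - ‖gradient φ 0‖) ≤ φ y := by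
      intro y
      have h2 := hle 0 y
      rw [sub_zero] at h2
      have h3 := neg_le_of_abs_le (abs_real_inner_le_norm (gradient φ 0) y)
      nlinarith
    refine tendsto_atTop_mono h1 (tendsto_atTop_add_const_left _ _ ?_)
    have hn := tendsto_norm_cocompact_atTop (E := E)
    refine hn.atTop_mul_atTop₀ ?_
    exact tendsto_atTop_add_const_right _ _ (hn.const_mul_atTop (by positivity))
  obtain ⟨x, hx⟩ := hd.continuous.exists_forall_le hcoer
  refine ⟨x, ?_⟩
  have : fderiv ℝ φ x = 0 := IsLocalMin.fderiv_eq_zero (Eventually.of_forall hx)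
  simp [gradient, this]

theorem StronglyConvex.inner_gradient_sub_ge {φ : E → ℝ} {μ : ℝ} (hφ : StronglyConvex φ μ)
    (x x' : E) : μ * ‖x - x'‖ ^ 2 ≤ inner ℝ (gradient φ x - gradient φ x') (x - x') := by
  have h1 := hφ.2.2 x x'
  have h2 := hφ.2.2 x' x
  have h3 : inner ℝ (gradient φ x) (x' - x) = - inner ℝ (gradient φ x) (x - x') := by
    rw [← inner_neg_right, neg_sub]
  rw [norm_sub_rev x' x] at h1
  rw [inner_sub_left]
  linarith

end Smooth

/-! ### The multiplier step -/

section Step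

variable {E Y : Type*} [NormedAddCommGroup E] [InnerProductSpace ℝ E]
  [NormedAddCommGroup Y] [InnerProductSpace ℝ Y] {G : Y → EReal} {B : E →ₗ[ℝ] Y} {σ : ℝ}

/-- The updates of `y` and `lam` in one step of the augmented Lagrangian method that starts from
the multiplier `lam₀` and uses the primal point `x`. The optimality condition of the proximal step
that defines `y` reads `-lam ∈ ∂G y`. -/
structure MultiplierStep (G : Y → EReal) (B : E →ₗ[ℝ] Y) (σ : ℝ) (lam₀ : Y) (x : E) (y lam : Y) :
    Prop where
  eq_sub : lam = lam₀ - σ • (B x - y)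
  neg_mem : -lam ∈ subdiff G y

theorem IsProx.multiplierStep (hG : ClosedProperConvex G) (hσ : 0 < σ) {lam₀ y : Y} {x : E}
    (h : IsProx G σ (B x - (1 / σ) • lam₀) y) :
    MultiplierStep G B σ lam₀ x y (lam₀ - σ • (B x - y)) := by
  refine ⟨rfl, ?_⟩
  have := h.smul_sub_mem_subdiff hG
  convert this using 1
  rw [smul_sub, smul_sub, smul_sub, smul_smul, mul_one_div_cancel hσ.ne', one_smul]
  abel

theorem MultiplierStep.sub_eq (hσ : 0 < σ) {lam₀ y lam : Y} {x : E}
    (h : MultiplierStep G B σ lam₀ x y lam) : y - B x = (1 / σ) • (lam - lam₀) := by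
  rw [h.eq_sub, sub_sub_cancel_left, smul_neg, smul_smul, one_div_mul_cancel hσ.ne', one_smul,
    neg_sub]

end Step

/-! ### Duality for `min F x + G (B x)` -/

section Duality

variable {E Y : Type*} [NormedAddCommGroup E] [InnerProductSpace ℝ E] [FiniteDimensional ℝ E]
  [NormedAddCommGroup Y] [InnerProductSpace ℝ Y] [FiniteDimensional ℝ Y]
  {F : E → ℝ} {G : Y → EReal} {B : E →ₗ[ℝ] Y} {μ σ : ℝ}

/-- The function `H lam = F*(Bᵀ lam) + G*(-lam)` for a real-valued `F`. -/
noncomputable def dualFun (F : E → ℝ) (G : Y → EReal) (B : E →ₗ[ℝ] Y) (lam : Y) : EReal :=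
  conj (fun x => (F x : EReal)) (LinearMap.adjoint B lam) + conj G (-lam)

/-- The set of minimizers of `H`. -/
abbrev dualMinimizers (F : E → ℝ) (G : Y → EReal) (B : E →ₗ[ℝ] Y) : Set Y :=
  {lam | ∀ ν, dualFun F G B lam ≤ dualFun F G B ν}

/-- The residual `∇F x - Bᵀ lam` of the stationarity condition of the Lagrangian in `x`. -/
noncomputable def residual (F : E → ℝ) (B : E →ₗ[ℝ] Y) (x : E) (lam : Y) : E :=
  gradient F x - LinearMap.adjoint B lam

theorem le_dualFun (hG : ClosedProperConvex G) (x : E) {y : Y} (hy : y ∈ effDom G) (lam : Y) :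
    ((inner ℝ lam (B x - y) - F x - (G y).toReal : ℝ) : EReal) ≤ dualFun F G B lam := by
  have h1 : ((inner ℝ x (LinearMap.adjoint B lam) - F x : ℝ) : EReal) ≤
      conj (fun x => (F x : EReal)) (LinearMap.adjoint B lam) := by
    rw [EReal.coe_sub]
    exact le_iSup (fun z => ((inner ℝ z (LinearMap.adjoint B lam) : ℝ) : EReal) - (F z : EReal)) x
  have h2 : ((inner ℝ y (-lam) - (G y).toReal : ℝ) : EReal) ≤ conj G (-lam) := by
    rw [EReal.coe_sub, hG.coe_toReal hy]
    exact le_iSup (fun z => ((inner ℝ z (-lam) : ℝ) : EReal) - G z) y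
  refine le_trans (le_of_eq ?_) (add_le_add h1 h2)
  rw [← EReal.coe_add, LinearMap.adjoint_inner_right, inner_neg_right, inner_sub_right,
    real_inner_comm lam, real_inner_comm lam]
  congr 1
  ring

/-- Equality in Fenchel's inequalities for `F` and `G`. -/
theorem dualFun_eq (hF : StronglyConvex F μ) (hG : ClosedProperConvex G) {x : E} {y lam : Y}
    (hx : residual F B x lam = 0) (hy : -lam ∈ subdiff G y) :
    dualFun F G B lam = ((inner ℝ lam (B x - y) - F x - (G y).toReal : ℝ) : EReal) := by
  have hyd := (hG.mem_subdiff_iff.1 hy).1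
  refine le_antisymm ?_ (le_dualFun hG x hyd lam)
  have h1 : conj (fun x => (F x : EReal)) (LinearMap.adjoint B lam) ≤
      ((inner ℝ x (LinearMap.adjoint B lam) - F x : ℝ) : EReal) := by
    refine iSup_le fun z => ?_
    rw [← EReal.coe_sub, EReal.coe_le_coe_iff]
    have h := hF.2.2 x z
    rw [sub_eq_zero.1 hx, inner_sub_right] at h
    have h0 : 0 ≤ 1 / 2 * μ * ‖z - x‖ ^ 2 := by have := hF.1; positivity
    rw [real_inner_comm, real_inner_comm _ x]
    linarith
  have h2 : conj G (-lam) ≤ ((inner ℝ y (-lam) - (G y).toReal : ℝ) : EReal) := by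
    refine iSup_le fun z => ?_
    by_cases hz : z ∈ effDom G
    · rw [← hG.coe_toReal hz, ← EReal.coe_sub, EReal.coe_le_coe_iff]
      have h := (hG.mem_subdiff_iff.1 hy).2 z hz
      rw [inner_sub_right] at h
      rw [real_inner_comm, real_inner_comm _ y]
      linarith
    · rw [eq_top_of_notMem_effDom hz, EReal.sub_top]
      exact bot_le
  refine (add_le_add h1 h2).trans (le_of_eq ?_)
  rw [← EReal.coe_add, LinearMap.adjoint_inner_right, inner_neg_right, inner_sub_right,
    real_inner_comm lam, real_inner_comm lam]
  congr 1
  ring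

theorem sub_mem_subdiff_dualFun (hF : StronglyConvex F μ) (hG : ClosedProperConvex G) {x : E}
    {y lam : Y} (hx : residual F B x lam = 0) (hy : -lam ∈ subdiff G y) :
    B x - y ∈ subdiff (dualFun F G B) lam := by
  intro ν
  rw [dualFun_eq hF hG hx hy, ← EReal.coe_add]
  refine le_trans (le_of_eq ?_) (le_dualFun hG x (hG.mem_subdiff_iff.1 hy).1 ν)
  rw [inner_sub_right (B x - y), real_inner_comm ν, real_inner_comm lam]
  congr 1
  ring

/-! ### Exact minimization in the primal variable -/

theorem IsProx.moreauEnv_comp_bounds (hG : ClosedProperConvex G) (hσ : 0 < σ) {c y : Y} {x : E}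
    (h : IsProx G σ (B x - c) y) (x' : E) :
    moreauEnv G σ (B x - c) + inner ℝ (LinearMap.adjoint B (σ • (B x - c - y))) (x' - x) ≤
        moreauEnv G σ (B x' - c) ∧
      moreauEnv G σ (B x' - c) ≤
        moreauEnv G σ (B x - c) + inner ℝ (LinearMap.adjoint B (σ • (B x - c - y))) (x' - x) +
          σ / 2 * ‖LinearMap.toContinuousLinearMap B‖ ^ 2 * ‖x' - x‖ ^ 2 := by
  have e : B x' - c - (B x - c) = B (x' - x) := by rw [map_sub]; abel
  have h1 := h.le_moreauEnv hG hσ (B x' - c)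
  have h2 := h.moreauEnv_le hG hσ (B x' - c)
  rw [e] at h1 h2
  rw [LinearMap.adjoint_inner_left]
  refine ⟨h1, h2.trans ?_⟩
  have h3 : ‖B (x' - x)‖ ≤ ‖LinearMap.toContinuousLinearMap B‖ * ‖x' - x‖ :=
    (LinearMap.toContinuousLinearMap B).le_opNorm (x' - x)
  have h4 : ‖B (x' - x)‖ ^ 2 ≤ ‖LinearMap.toContinuousLinearMap B‖ ^ 2 * ‖x' - x‖ ^ 2 := by
    rw [← mul_pow]
    exact pow_le_pow_left₀ (norm_nonneg _) h3 2
  have h5 := mul_le_mul_of_nonneg_left h4 (by positivity : 0 ≤ σ / 2)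
  linarith

/-- The function minimized in `x` by the augmented Lagrangian method. -/
noncomputable def augFun (F : E → ℝ) (G : Y → EReal) (B : E →ₗ[ℝ] Y) (σ : ℝ) (lam₀ : Y) (x : E) :
    ℝ :=
  F x + (moreauEnv G σ (B x - (1 / σ) • lam₀) - 1 / (2 * σ) * ‖lam₀‖ ^ 2)

theorem residual_update (hσ : 0 < σ) (lam₀ y : Y) (x : E) :
    residual F B x (lam₀ - σ • (B x - y)) =
      gradient F x + LinearMap.adjoint B (σ • (B x - (1 / σ) • lam₀ - y)) := by
  rw [residual, sub_eq_add_neg, ← map_neg]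
  congr 2
  rw [smul_sub, smul_sub, smul_sub, smul_smul, mul_one_div_cancel hσ.ne', one_smul]
  abel

/-- The gradient of the function minimized in `x` is the stationarity residual at the updated
multiplier. -/
theorem IsProx.hasGradientAt_augFun (hF : StronglyConvex F μ) (hG : ClosedProperConvex G)
    (hσ : 0 < σ) {lam₀ y : Y} {x : E} (h : IsProx G σ (B x - (1 / σ) • lam₀) y) :
    HasGradientAt (augFun F G B σ lam₀) (residual F B x (lam₀ - σ • (B x - y))) x := by
  have h1 := h.moreauEnv_comp_bounds hG hσ
  rw [residual_update hσ]
  exact hasGradientAt_add (hF.2.1 x).hasGradientAt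
    (hasGradientAt_of_sq_bound
      (φ := fun x => moreauEnv G σ (B x - (1 / σ) • lam₀) - 1 / (2 * σ) * ‖lam₀‖ ^ 2)
      (C := σ / 2 * ‖LinearMap.toContinuousLinearMap B‖ ^ 2)
      (fun x' => by linarith [(h1 x').1]) (fun x' => by linarith [(h1 x').2]))

theorem stronglyConvex_augFun (hF : StronglyConvex F μ) (hG : ClosedProperConvex G)
    (hσ : 0 < σ) (lam₀ : Y) : StronglyConvex (augFun F G B σ lam₀) μ := by
  refine ⟨hF.1, fun x => ?_, fun x x' => ?_⟩
  · obtain ⟨y, hy⟩ := hG.exists_isProx hσ (B x - (1 / σ) • lam₀)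
    exact (hy.hasGradientAt_augFun hF hG hσ).differentiableAt
  · obtain ⟨y, hy⟩ := hG.exists_isProx hσ (B x - (1 / σ) • lam₀)
    have h1 := (hy.moreauEnv_comp_bounds hG hσ x').1
    have h2 := hF.2.2 x x'
    rw [(hy.hasGradientAt_augFun hF hG hσ).gradient, residual_update hσ, inner_add_left]
    simp only [augFun]
    linarith

/-- Exact minimization in `x` is possible. The resulting multiplier is the proximal point of `lam₀`
for the dual function. -/
theorem exists_exact_multiplierStep (hF : StronglyConvex F μ) (hG : ClosedProperConvex G)
    (B : E →ₗ[ℝ] Y) (hσ : 0 < σ) (lam₀ : Y) :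
    ∃ x y lam, MultiplierStep G B σ lam₀ x y lam ∧ residual F B x lam = 0 := by
  obtain ⟨x, hx⟩ := (stronglyConvex_augFun (B := B) hF hG hσ lam₀).exists_gradient_eq_zero
  obtain ⟨y, hy⟩ := hG.exists_isProx hσ (B x - (1 / σ) • lam₀)
  rw [(hy.hasGradientAt_augFun hF hG hσ).gradient] at hx
  exact ⟨x, y, _, hy.multiplierStep hG hσ, hx⟩

/-! ### Estimates for one step -/

/-- Monotonicity of `∇F` and of `∂G`, combined along the Lagrangian. -/
theorem residual_monotone (hF : StronglyConvex F μ) (hG : ClosedProperConvex G) {x x' : E}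
    {y y' lam lam' : Y} (h : -lam ∈ subdiff G y) (h' : -lam' ∈ subdiff G y') :
    μ * ‖x - x'‖ ^ 2 + inner ℝ (lam - lam') ((y - B x) - (y' - B x')) ≤
      inner ℝ (residual F B x lam - residual F B x' lam') (x - x') := by
  have h1 := hF.inner_gradient_sub_ge x x'
  have h2 := inner_subdiff_nonneg hG h h'
  have e1 : -lam - -lam' = -(lam - lam') := by abel
  rw [e1, inner_neg_left] at h2
  have e2 : residual F B x lam - residual F B x' lam' =
      (gradient F x - gradient F x') - LinearMap.adjoint B (lam - lam') := by
    rw [residual, residual, map_sub]; abel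
  have e3 : (y - B x) - (y' - B x') = (y - y') - B (x - x') := by rw [map_sub]; abel
  rw [e2, e3, inner_sub_left (gradient F x - gradient F x'), inner_sub_right,
    LinearMap.adjoint_inner_left]
  linarith

/-- The distance from the computed multiplier to the one of exact minimization is controlled by
the residual. -/
theorem MultiplierStep.norm_sub_exact_sq_le (hF : StronglyConvex F μ) (hG : ClosedProperConvex G)
    (hσ : 0 < σ) {lam₀ y y' lam lam' : Y} {x x' : E} (h : MultiplierStep G B σ lam₀ x y lam)
    (h' : MultiplierStep G B σ lam₀ x' y' lam') (hr : residual F B x' lam' = 0) :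
    4 * μ * ‖lam - lam'‖ ^ 2 ≤ σ * ‖residual F B x lam‖ ^ 2 := by
  have h1 := residual_monotone (B := B) (x := x) (x' := x') hF hG h.neg_mem h'.neg_mem
  rw [h.sub_eq hσ, h'.sub_eq hσ, ← smul_sub, sub_sub_sub_cancel_right, real_inner_smul_right,
    real_inner_self_eq_norm_sq, hr, sub_zero] at h1
  have h2 := real_inner_le_norm (residual F B x lam) (x - x')
  have h3 := mul_le_mul_of_nonneg_left (h1.trans h2) hσ.le
  rw [mul_add, ← mul_assoc σ (1 / σ), mul_one_div_cancel hσ.ne', one_mul] at h3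
  have h4 := mul_le_mul_of_nonneg_left h3 hF.1.le
  have h5 := mul_nonneg hσ.le (sq_nonneg (‖residual F B x lam‖ - 2 * μ * ‖x - x'‖))
  linarith

/-- The central estimate for one step, against a primal-dual solution `(xs, B xs, ls)`. -/
theorem MultiplierStep.inner_le (hF : StronglyConvex F μ) (hG : ClosedProperConvex G)
    (hσ : 0 < σ) {lam₀ y lam ls : Y} {x xs : E} (h : MultiplierStep G B σ lam₀ x y lam)
    (hr : residual F B xs ls = 0) (hs : -ls ∈ subdiff G (B xs)) :
    μ * ‖x - xs‖ ^ 2 + 1 / σ * inner ℝ (lam - ls) (lam - lam₀) ≤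
      ‖residual F B x lam‖ * ‖x - xs‖ := by
  have h1 := residual_monotone (B := B) (x := x) (x' := xs) hF hG h.neg_mem hs
  rw [h.sub_eq hσ, sub_self, sub_zero, real_inner_smul_right, hr, sub_zero] at h1
  exact h1.trans (real_inner_le_norm _ _)

/-- Fejér monotonicity with respect to the dual solutions, up to the residual. -/
theorem MultiplierStep.fejer (hF : StronglyConvex F μ) (hG : ClosedProperConvex G)
    (hσ : 0 < σ) {lam₀ y lam ls : Y} {x xs : E} (h : MultiplierStep G B σ lam₀ x y lam)
    (hr : residual F B xs ls = 0) (hs : -ls ∈ subdiff G (B xs)) :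
    ‖lam - ls‖ ^ 2 + ‖lam - lam₀‖ ^ 2 ≤
      ‖lam₀ - ls‖ ^ 2 + σ / (2 * μ) * ‖residual F B x lam‖ ^ 2 := by
  have hμ := hF.1
  have h1 := mul_le_mul_of_nonneg_left (h.inner_le hF hG hσ hr hs) hσ.le
  rw [mul_add, ← mul_assoc σ (1 / σ), mul_one_div_cancel hσ.ne', one_mul] at h1
  have e : lam₀ - ls = (lam - ls) - (lam - lam₀) := by abel
  rw [e, norm_sub_sq_real (lam - ls)]
  have h2 : 2 * (σ * (‖residual F B x lam‖ * ‖x - xs‖) - σ * (μ * ‖x - xs‖ ^ 2)) ≤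
      σ / (2 * μ) * ‖residual F B x lam‖ ^ 2 := by
    have h3 : σ / (2 * μ) * ‖residual F B x lam‖ ^ 2 -
        2 * (σ * (‖residual F B x lam‖ * ‖x - xs‖) - σ * (μ * ‖x - xs‖ ^ 2)) =
        σ / (2 * μ) * (‖residual F B x lam‖ - 2 * μ * ‖x - xs‖) ^ 2 := by
      field_simp
      ring
    have h4 : 0 ≤ σ / (2 * μ) * (‖residual F B x lam‖ - 2 * μ * ‖x - xs‖) ^ 2 := by positivity
    linarith
  linarith

/-! ### Primal and dual solutions -/

/-- A proximal step for the dual function that starts at a minimizer stays there, so that the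
primal points it uses complete the multiplier to a primal-dual solution. -/
theorem exists_of_mem_dualMinimizers (hF : StronglyConvex F μ) (hG : ClosedProperConvex G)
    {lam : Y} (h : lam ∈ dualMinimizers F G B) :
    ∃ x, residual F B x lam = 0 ∧ -lam ∈ subdiff G (B x) := by
  obtain ⟨x, y, lam', hs, hr⟩ := exists_exact_multiplierStep hF hG B one_pos lam
  have h1 := sub_mem_subdiff_dualFun hF hG hr hs.neg_mem lam
  have h2 := h1.trans (h lam')
  have e : B x - y = lam - lam' := by
    rw [← neg_sub y, hs.sub_eq one_pos, div_one, one_smul, neg_sub]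
  rw [dualFun_eq hF hG hr hs.neg_mem, ← EReal.coe_add, EReal.coe_le_coe_iff, e,
    real_inner_self_eq_norm_sq] at h2
  have h3 : lam - lam' = 0 := by
    rw [← norm_eq_zero, ← sq_eq_zero_iff]
    exact le_antisymm (by linarith) (sq_nonneg _)
  have h4 : lam' = lam := (sub_eq_zero.1 h3).symm
  have h5 : B x = y := sub_eq_zero.1 (e.trans h3)
  subst h4 h5
  exact ⟨x, hr, hs.neg_mem⟩

theorem residual_unique (hF : StronglyConvex F μ) (hG : ClosedProperConvex G) {x x' : E}
    {lam lam' : Y} (hr : residual F B x lam = 0) (hs : -lam ∈ subdiff G (B x))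
    (hr' : residual F B x' lam' = 0) (hs' : -lam' ∈ subdiff G (B x')) : x = x' := by
  have h := residual_monotone (B := B) (x := x) (x' := x') hF hG hs hs'
  rw [hr, hr', sub_self, sub_self, sub_self, inner_zero_right, sub_zero, inner_zero_left,
    add_zero] at h
  have h1 : ‖x - x'‖ ^ 2 ≤ 0 := nonpos_of_mul_nonpos_right h hF.1
  have h2 : ‖x - x'‖ = 0 := sq_eq_zero_iff.1 (le_antisymm h1 (sq_nonneg _))
  exact sub_eq_zero.1 (norm_eq_zero.1 h2)

/-- All dual solutions are multipliers of one and the same primal point. -/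
theorem mem_dualMinimizers_iff (hF : StronglyConvex F μ) (hG : ClosedProperConvex G) {xs : E}
    {ls : Y} (hr : residual F B xs ls = 0) (hs : -ls ∈ subdiff G (B xs)) {lam : Y} :
    lam ∈ dualMinimizers F G B ↔
      residual F B xs lam = 0 ∧ -lam ∈ subdiff G (B xs) := by
  constructor
  · intro h
    obtain ⟨x, hr', hs'⟩ := exists_of_mem_dualMinimizers hF hG h
    rw [residual_unique hF hG hr hs hr' hs']
    exact ⟨hr', hs'⟩
  · rintro ⟨hr', hs'⟩
    have h := sub_mem_subdiff_dualFun hF hG hr' hs'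
    rw [sub_self] at h
    have h' : lam ∈ invImage (subdiff (dualFun F G B)) 0 := h
    rwa [invImage_subdiff_zero] at h'

theorem isClosed_dualMinimizers (hF : StronglyConvex F μ) (hG : ClosedProperConvex G) :
    IsClosed (dualMinimizers F G B) := by
  by_cases hne : ∃ ls, ls ∈ dualMinimizers F G B
  · obtain ⟨ls, hls⟩ := hne
    obtain ⟨xs, hr, hs⟩ := exists_of_mem_dualMinimizers hF hG hls
    have : dualMinimizers F G B =
        {lam | residual F B xs lam = 0} ∩ (fun lam => -lam) ⁻¹' subdiff G (B xs) := by
      ext lam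
      exact mem_dualMinimizers_iff hF hG hr hs
    rw [this]
    refine IsClosed.inter ?_ ((isClosed_subdiff hG _).preimage continuous_neg)
    have hc : Continuous fun lam => residual F B xs lam :=
      continuous_const.sub (LinearMap.continuous_of_finiteDimensional _)
    exact isClosed_singleton.preimage hc
  · have : dualMinimizers F G B = ∅ := by
      ext lam
      exact iff_of_false (fun h => hne ⟨lam, h⟩) (Set.notMem_empty lam)
    simp [this]

/-- Quadratic growth of the primal objective around the primal point of a primal-dual solution. -/
theorem primal_growth (hF : StronglyConvex F μ) (hG : ClosedProperConvex G) {xs : E} {ls : Y}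
    (hr : residual F B xs ls = 0) (hs : -ls ∈ subdiff G (B xs)) {x : E} (hx : B x ∈ effDom G) :
    F xs + (G (B xs)).toReal + 1 / 2 * μ * ‖x - xs‖ ^ 2 ≤ F x + (G (B x)).toReal := by
  have h1 := hF.2.2 xs x
  have h2 := (hG.mem_subdiff_iff.1 hs).2 _ hx
  rw [sub_eq_zero.1 hr, LinearMap.adjoint_inner_left] at h1
  rw [inner_neg_left, ← map_sub] at h2
  linarith

end Duality

/-! ### Real inequalities -/

/-- A deterministic form of the supermartingale convergence theorem. -/
theorem tendsto_of_add_le_add_summable {a b c : ℕ → ℝ} (ha : ∀ k, 0 ≤ a k) (hb : ∀ k, 0 ≤ b k)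
    (hc : ∀ k, 0 ≤ c k) (hcs : Summable c) (h : ∀ k, a (k + 1) + b k ≤ a k + c k) :
    (∃ l, Tendsto a atTop (𝓝 l)) ∧ Tendsto b atTop (𝓝 0) := by
  set s : ℕ → ℝ := fun k => ∑ i ∈ Finset.range k, c i with hs
  have hs_lim : Tendsto s atTop (𝓝 (∑' i, c i)) := hcs.hasSum.tendsto_sum_nat
  have hanti : Antitone fun k => a k - s k := by
    refine antitone_nat_of_succ_le fun k => ?_
    have : s (k + 1) = s k + c k := Finset.sum_range_succ _ _
    have := h k
    have := hb k
    linarith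
  have hbdd : BddBelow (Set.range fun k => a k - s k) := by
    refine ⟨-∑' i, c i, ?_⟩
    rintro _ ⟨k, rfl⟩
    have : s k ≤ ∑' i, c i := hcs.sum_le_tsum _ fun i _ => hc i
    have := ha k
    simp only
    linarith
  have hu := tendsto_atTop_ciInf hanti hbdd
  have ha_lim : Tendsto a atTop (𝓝 ((⨅ k, (a k - s k)) + ∑' i, c i)) := by
    simpa using hu.add hs_lim
  refine ⟨⟨_, ha_lim⟩, ?_⟩
  have h1 : Tendsto (fun k => a k - a (k + 1) + c k) atTop (𝓝 0) := by
    simpa using (ha_lim.sub (ha_lim.comp (tendsto_add_atTop_nat 1))).add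
      hcs.tendsto_atTop_zero
  exact squeeze_zero hb (fun k => by linarith [h k]) h1

/-- The contraction factor of an exact step: `r` is the distance of the starting point to the
solution set, `d` the distance of the end point, and `e` the length of the step. -/
theorem le_div_sqrt_mul {a σ d e r : ℝ} (ha : 0 ≤ a) (hσ : 0 < σ) (hr : 0 ≤ r) (hd : 0 ≤ d)
    (h : d ^ 2 + e ^ 2 ≤ r ^ 2) (h' : d ≤ a * (1 / σ * e)) : d ≤ a / √(a ^ 2 + σ ^ 2) * r := by
  have h1 : σ * d ≤ a * e := by
    have := mul_le_mul_of_nonneg_left h' hσ.le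
    have e1 : σ * (a * (1 / σ * e)) = a * e := by field_simp
    linarith
  have h2 : (σ * d) ^ 2 ≤ (a * e) ^ 2 := pow_le_pow_left₀ (by positivity) h1 2
  have h3 : 0 < a ^ 2 + σ ^ 2 := by positivity
  rw [div_mul_eq_mul_div, le_div_iff₀ (Real.sqrt_pos.2 h3)]
  refine abs_le_of_sq_le_sq' ?_ (by positivity) |>.2
  rw [mul_pow, Real.sq_sqrt h3.le]
  have h4 := mul_le_mul_of_nonneg_left h (sq_nonneg a)
  nlinarith

/-- The contraction factor of an inexact step of length `q` that ends at distance `s` from the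
solution set, in terms of the exact step, which ends at distance `d`; `t` is the distance of the two
end points. -/
theorem le_theta_mul {c δ d q r s t : ℝ} (hc : 0 ≤ c) (hδ : 0 ≤ δ) (hδ1 : δ < 1) (hr : 0 ≤ r)
    (hs : s ≤ d + t) (hd : d ≤ c * r) (ht : t ≤ δ * q) (hq : q ≤ r + t) :
    s ≤ (c + 2 * δ) / (1 - δ) * r := by
  have h1 : 0 < 1 - δ := by linarith
  rw [div_mul_eq_mul_div, le_div_iff₀ h1]
  have h2 : (1 - δ) * q ≤ r := by linarith
  have h3 : δ * ((1 - δ) * q) ≤ δ * r := mul_le_mul_of_nonneg_left h2 hδ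
  have h4 : s ≤ c * r + δ * q := by linarith
  have h5 := mul_le_mul_of_nonneg_right h4 h1.le
  have h6 : 0 ≤ δ * (c * r) := by positivity
  have h7 : 0 ≤ δ * r := by positivity
  linarith

/-! ### Convergence of the method -/

theorem tendsto_residual {E : Type*} [NormedAddCommGroup E] {μ s : ℝ} {σ ε : ℕ → ℝ} {r : ℕ → E}
    (hμ : 0 < μ) (hs : 0 < s) (hσs : ∀ k, s ≤ σ k) (hε : Tendsto ε atTop (𝓝 0))
    (hA : ∀ k, ‖r k‖ ^ 2 ≤ ε k ^ 2 * μ / σ k) : Tendsto (fun k => ‖r k‖) atTop (𝓝 0) := by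
  have h1 : Tendsto (fun k => ε k ^ 2 * μ / s) atTop (𝓝 0) := by
    simpa using ((hε.pow 2).mul_const μ).div_const s
  have h2 : Tendsto (fun k => ‖r k‖ ^ 2) atTop (𝓝 0) :=
    squeeze_zero (fun k => sq_nonneg _)
      (fun k => (hA k).trans (div_le_div_of_nonneg_left (by positivity) hs (hσs k))) h1
  simpa [Real.sqrt_sq (norm_nonneg _)] using h2.sqrt

theorem tendsto_linearMap_comp {E Y : Type*} [NormedAddCommGroup E] [InnerProductSpace ℝ E]
    [FiniteDimensional ℝ E] [NormedAddCommGroup Y] [InnerProductSpace ℝ Y] (B : E →ₗ[ℝ] Y)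
    {u : ℕ → E} {v : E} (h : Tendsto u atTop (𝓝 v)) : Tendsto (fun k => B (u k)) atTop (𝓝 (B v)) :=
  ((LinearMap.continuous_of_finiteDimensional B).tendsto v).comp h

section Convergence

variable {E Y : Type*} [NormedAddCommGroup E] [InnerProductSpace ℝ E] [FiniteDimensional ℝ E]
  [NormedAddCommGroup Y] [InnerProductSpace ℝ Y] [FiniteDimensional ℝ Y]
  {F : E → ℝ} {G : Y → EReal} {B : E →ₗ[ℝ] Y} {μ : ℝ}

/-- The proximal point `p` of `lam₀` for the dual function: it satisfies the Fejér inequality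
without error, the scaled step is a dual subgradient, and it is close to every inexact update. -/
theorem exists_dual_prox (hF : StronglyConvex F μ) (hG : ClosedProperConvex G) (B : E →ₗ[ℝ] Y)
    {σ : ℝ} (hσ : 0 < σ) (lam₀ : Y) :
    ∃ p, (∀ ls ∈ dualMinimizers F G B, ‖p - ls‖ ^ 2 + ‖p - lam₀‖ ^ 2 ≤ ‖lam₀ - ls‖ ^ 2) ∧
      (1 / σ) • (lam₀ - p) ∈ subdiff (dualFun F G B) p ∧
      ∀ x y lam, MultiplierStep G B σ lam₀ x y lam →
        4 * μ * ‖lam - p‖ ^ 2 ≤ σ * ‖residual F B x lam‖ ^ 2 := by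
  obtain ⟨x, y, p, hs, hr⟩ := exists_exact_multiplierStep hF hG B hσ lam₀
  refine ⟨p, fun ls hls => ?_, ?_, fun x' y' lam h => h.norm_sub_exact_sq_le hF hG hσ hs hr⟩
  · obtain ⟨xs, hrs, hss⟩ := exists_of_mem_dualMinimizers hF hG hls
    have := hs.fejer hF hG hσ hrs hss
    rwa [hr, norm_zero, zero_pow two_ne_zero, mul_zero, add_zero] at this
  · have := sub_mem_subdiff_dualFun hF hG hr hs.neg_mem
    rwa [← neg_sub y, hs.sub_eq hσ, ← smul_neg, neg_sub] at this

variable {σ ε δ : ℕ → ℝ} {x : ℕ → E} {y lam : ℕ → Y}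

/-- Criterion (A') makes the dual iterates quasi-Fejér monotone. -/
theorem quasi_fejer (hF : StronglyConvex F μ) (hG : ClosedProperConvex G) (hσ : ∀ k, 0 < σ k)
    (hstep : ∀ k, MultiplierStep G B (σ k) (lam k) (x (k + 1)) (y (k + 1)) (lam (k + 1)))
    (hε : ∀ k, 0 ≤ ε k) (hεs : Summable ε)
    (hA : ∀ k, ‖residual F B (x (k + 1)) (lam (k + 1))‖ ^ 2 ≤ ε k ^ 2 * μ / σ k)
    {ls : Y} (hls : ls ∈ dualMinimizers F G B) :
    (∃ l, Tendsto (fun k => ‖lam k - ls‖ ^ 2) atTop (𝓝 l)) ∧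
      Tendsto (fun k => ‖lam (k + 1) - lam k‖) atTop (𝓝 0) := by
  have hμ := hF.1
  obtain ⟨xs, hrs, hss⟩ := exists_of_mem_dualMinimizers hF hG hls
  have hsq : Summable fun k => ε k ^ 2 := by
    refine Summable.of_norm_bounded_eventually_nat hεs ?_
    filter_upwards [hεs.tendsto_atTop_zero.eventually (eventually_le_nhds one_pos)] with k hk
    rw [Real.norm_of_nonneg (by positivity), sq]
    exact mul_le_of_le_one_left (hε k) hk
  have hle : ∀ k, ‖lam (k + 1) - ls‖ ^ 2 + ‖lam (k + 1) - lam k‖ ^ 2 ≤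
      ‖lam k - ls‖ ^ 2 + ε k ^ 2 / 2 := by
    intro k
    have h1 := (hstep k).fejer hF hG (hσ k) hrs hss
    have h2 : σ k / (2 * μ) * ‖residual F B (x (k + 1)) (lam (k + 1))‖ ^ 2 ≤
        σ k / (2 * μ) * (ε k ^ 2 * μ / σ k) :=
      mul_le_mul_of_nonneg_left (hA k) (div_nonneg (hσ k).le (by linarith))
    have h3 : σ k / (2 * μ) * (ε k ^ 2 * μ / σ k) = ε k ^ 2 / 2 := by
      have := (hσ k).ne'
      field_simp
    linarith
  obtain ⟨h1, h2⟩ := tendsto_of_add_le_add_summable (a := fun k => ‖lam k - ls‖ ^ 2)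
    (b := fun k => ‖lam (k + 1) - lam k‖ ^ 2) (fun k => sq_nonneg _) (fun k => sq_nonneg _)
    (fun k => by positivity) (hsq.div_const 2) hle
  refine ⟨h1, ?_⟩
  have h3 := h2.sqrt
  simpa [Real.sqrt_sq (norm_nonneg _)] using h3

/-- An upper bound on the squared residual, inserted into the estimate of the distance to the
proximal point. -/
theorem norm_le_of_criterion {μ σ d r t : ℝ} (hμ : 0 < μ) (hσ : 0 < σ) (ht : 0 ≤ t)
    (h : 4 * μ * d ^ 2 ≤ σ * r ^ 2) (hr : r ^ 2 ≤ t ^ 2 * μ / σ) : d ≤ t := by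
  have h1 := mul_le_mul_of_nonneg_left hr hσ.le
  rw [mul_div_cancel₀ _ hσ.ne'] at h1
  have h2 : μ * d ^ 2 ≤ μ * t ^ 2 := by
    have := mul_nonneg hμ.le (sq_nonneg d)
    linarith
  exact (abs_le_of_sq_le_sq' (le_of_mul_le_mul_left h2 hμ) ht).2

/-- Local estimate for the proximal point: the error bound applies at `p` with the subgradient
`(lam₀ - p) / σ`. -/
theorem ErrorBound.eventually_prox {a : ℝ} (hEB : ErrorBound (subdiff (dualFun F G B)) 0 a)
    {s : ℝ} (hs : 0 < s) (hσs : ∀ k, s ≤ σ k) {p : ℕ → Y}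
    (hp : ∀ k, (1 / σ k) • (lam k - p k) ∈ subdiff (dualFun F G B) (p k))
    (hlim : Tendsto (fun k => ‖p k - lam k‖) atTop (𝓝 0)) :
    ∀ᶠ k in atTop, Metric.infDist (p k) (dualMinimizers F G B) ≤
      a * (1 / σ k * ‖p k - lam k‖) := by
  obtain ⟨ha, -, ε, hε, h⟩ := hEB
  rw [invImage_subdiff_zero] at h
  filter_upwards [hlim.eventually (eventually_le_nhds (mul_pos hs hε))] with k hk
  have hσ : 0 < σ k := hs.trans_le (hσs k)
  have h1 : Metric.infDist 0 (subdiff (dualFun F G B) (p k)) ≤ 1 / σ k * ‖p k - lam k‖ := by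
    refine (Metric.infDist_le_dist_of_mem (hp k)).trans (le_of_eq ?_)
    rw [dist_zero_left, norm_smul, Real.norm_of_nonneg (by positivity), norm_sub_rev]
  have h2 : 1 / σ k * ‖p k - lam k‖ ≤ ε := by
    rw [one_div_mul_eq_div, div_le_iff₀ hσ, mul_comm]
    exact hk.trans (mul_le_mul_of_nonneg_right (hσs k) hε.le)
  exact (h _ ⟨_, hp k⟩ (h1.trans h2)).trans (mul_le_mul_of_nonneg_left h1 ha)

/-- Convergence of the multipliers to a dual solution, and the linear rate of their distance to
the solution set. -/
theorem tendsto_dual (hF : StronglyConvex F μ) (hG : ClosedProperConvex G)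
    {a : ℝ} (hEB : ErrorBound (subdiff (dualFun F G B)) 0 a)
    {s : ℝ} (hs : 0 < s) (hσs : ∀ k, s ≤ σ k)
    (hstep : ∀ k, MultiplierStep G B (σ k) (lam k) (x (k + 1)) (y (k + 1)) (lam (k + 1)))
    (hε : ∀ k, 0 ≤ ε k) (hεs : Summable ε)
    (hA : ∀ k, ‖residual F B (x (k + 1)) (lam (k + 1))‖ ^ 2 ≤ ε k ^ 2 * μ / σ k)
    (hδ : ∀ k, 0 ≤ δ k) (hδ0 : Tendsto δ atTop (𝓝 0))
    (hB : ∀ k, ‖residual F B (x (k + 1)) (lam (k + 1))‖ ^ 2 ≤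
      δ k ^ 2 * μ / σ k * ‖lam (k + 1) - lam k‖ ^ 2) :
    (∃ ls ∈ dualMinimizers F G B, Tendsto lam atTop (𝓝 ls)) ∧
      ∀ᶠ k in atTop, Metric.infDist (lam (k + 1)) (dualMinimizers F G B) ≤
        theta a (σ k) (δ k) * Metric.infDist (lam k) (dualMinimizers F G B) := by
  have hσ : ∀ k, 0 < σ k := fun k => hs.trans_le (hσs k)
  have hne : (dualMinimizers F G B).Nonempty := by
    have := hEB.2.1
    rwa [invImage_subdiff_zero] at this
  have hclosed : IsClosed (dualMinimizers F G B) := isClosed_dualMinimizers hF hG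
  obtain ⟨l₀, hl₀⟩ := hne
  have hΔ := (quasi_fejer hF hG hσ hstep hε hεs hA hl₀).2
  choose p hpF hpS hpD using fun k => exists_dual_prox hF hG B (hσ k) (lam k)
  have hpA : ∀ k, ‖lam (k + 1) - p k‖ ≤ ε k := fun k =>
    norm_le_of_criterion hF.1 (hσ k) (hε k) (hpD k _ _ _ (hstep k)) (hA k)
  have hpB : ∀ k, ‖lam (k + 1) - p k‖ ≤ δ k * ‖lam (k + 1) - lam k‖ := fun k =>
    norm_le_of_criterion hF.1 (hσ k) (mul_nonneg (hδ k) (norm_nonneg _))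
      (hpD k _ _ _ (hstep k)) ((hB k).trans (le_of_eq (by ring)))
  have hpA0 : Tendsto (fun k => ‖lam (k + 1) - p k‖) atTop (𝓝 0) :=
    squeeze_zero (fun k => norm_nonneg _) hpA hεs.tendsto_atTop_zero
  have hplim : Tendsto (fun k => ‖p k - lam k‖) atTop (𝓝 0) := by
    refine squeeze_zero (fun k => norm_nonneg _) (fun k => ?_) (by simpa using hpA0.add hΔ)
    have := norm_sub_le_norm_sub_add_norm_sub (p k) (lam (k + 1)) (lam k)
    rwa [norm_sub_rev (p k) (lam (k + 1))] at this
  have hEBp := hEB.eventually_prox hs hσs hpS hplim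
  have hinf : ∀ k, Metric.infDist (lam (k + 1)) (dualMinimizers F G B) ≤
      Metric.infDist (p k) (dualMinimizers F G B) + ‖lam (k + 1) - p k‖ := fun k => by
    rw [← dist_eq_norm]
    exact Metric.infDist_le_infDist_add_dist
  refine ⟨?_, ?_⟩
  · -- the distance to the solution set tends to zero, so a cluster point is a solution
    have hdist : Tendsto (fun k => Metric.infDist (lam (k + 1)) (dualMinimizers F G B)) atTop
        (𝓝 0) := by
      have h1 : Tendsto (fun k => a * (1 / s * ‖p k - lam k‖) + ‖lam (k + 1) - p k‖) atTop
          (𝓝 0) := by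
        simpa using ((hplim.const_mul (1 / s)).const_mul a).add hpA0
      refine squeeze_zero' (Eventually.of_forall fun k => Metric.infDist_nonneg) ?_ h1
      filter_upwards [hEBp] with k hk
      have h2 : a * (1 / σ k * ‖p k - lam k‖) ≤ a * (1 / s * ‖p k - lam k‖) :=
        mul_le_mul_of_nonneg_left (mul_le_mul_of_nonneg_right
          (one_div_le_one_div_of_le hs (hσs k)) (norm_nonneg _)) hEB.1
      linarith [hinf k]
    have hdist' := (tendsto_add_atTop_iff_nat
      (f := fun k => Metric.infDist (lam k) (dualMinimizers F G B)) 1).1 hdist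
    obtain ⟨l, hl⟩ := (quasi_fejer hF hG hσ hstep hε hεs hA hl₀).1
    obtain ⟨r, hr⟩ := hl.bddAbove_range
    have hbdd : ∀ k, lam k ∈ Metric.closedBall l₀ √r := by
      intro k
      rw [mem_closedBall_iff_norm]
      exact Real.le_sqrt_of_sq_le (hr ⟨k, rfl⟩)
    obtain ⟨ls, -, φ, hφ, hls⟩ := (isCompact_closedBall l₀ √r).tendsto_subseq hbdd
    have hmem : ls ∈ dualMinimizers F G B := by
      rw [hclosed.mem_iff_infDist_zero ⟨l₀, hl₀⟩]
      exact tendsto_nhds_unique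
        (((Metric.continuous_infDist_pt _).tendsto ls).comp hls) (hdist'.comp hφ.tendsto_atTop)
    refine ⟨ls, hmem, ?_⟩
    obtain ⟨l, hl⟩ := (quasi_fejer hF hG hσ hstep hε hεs hA hmem).1
    have hsub : Tendsto (fun k => ‖lam (φ k) - ls‖ ^ 2) atTop (𝓝 0) := by
      have := ((tendsto_iff_norm_sub_tendsto_zero.1 hls).pow 2)
      simpa using this
    have hl0 : l = 0 := tendsto_nhds_unique (hl.comp hφ.tendsto_atTop) hsub
    rw [hl0] at hl
    rw [tendsto_iff_norm_sub_tendsto_zero]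
    simpa [Real.sqrt_sq (norm_nonneg _)] using hl.sqrt
  · filter_upwards [hEBp, hδ0.eventually (eventually_lt_nhds one_pos)] with k hk hδ1
    -- the nearest solution to `lam k`
    obtain ⟨ls, hls, hd⟩ := hclosed.exists_infDist_eq_dist ⟨l₀, hl₀⟩ (lam k)
    rw [dist_eq_norm] at hd
    have hF1 := hpF k ls hls
    rw [← hd] at hF1
    have h1 : Metric.infDist (p k) (dualMinimizers F G B) ≤ ‖p k - ls‖ := by
      rw [← dist_eq_norm]
      exact Metric.infDist_le_dist_of_mem hls
    have h2 : Metric.infDist (p k) (dualMinimizers F G B) ^ 2 ≤ ‖p k - ls‖ ^ 2 :=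
      pow_le_pow_left₀ Metric.infDist_nonneg h1 2
    have h3 := le_div_sqrt_mul hEB.1 (hσ k) Metric.infDist_nonneg Metric.infDist_nonneg
      (show _ + ‖p k - lam k‖ ^ 2 ≤ Metric.infDist (lam k) (dualMinimizers F G B) ^ 2 by
        linarith) hk
    have h4 : ‖p k - lam k‖ ≤ Metric.infDist (lam k) (dualMinimizers F G B) :=
      (abs_le_of_sq_le_sq' (by linarith [sq_nonneg ‖p k - ls‖]) Metric.infDist_nonneg).2
    have h5 := norm_sub_le_norm_sub_add_norm_sub (lam (k + 1)) (p k) (lam k)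
    exact le_theta_mul (div_nonneg hEB.1 (Real.sqrt_nonneg _)) (hδ k) hδ1 Metric.infDist_nonneg
      (hinf k) h3 (hpB k) (by linarith)

/-- The primal iterates converge since the residuals and the dual steps vanish. -/
theorem tendsto_primal (hF : StronglyConvex F μ) (hG : ClosedProperConvex G)
    {s : ℝ} (hs : 0 < s) (hσs : ∀ k, s ≤ σ k)
    (hstep : ∀ k, MultiplierStep G B (σ k) (lam k) (x (k + 1)) (y (k + 1)) (lam (k + 1)))
    (hres : Tendsto (fun k => ‖residual F B (x (k + 1)) (lam (k + 1))‖) atTop (𝓝 0))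
    {xs : E} {ls : Y} (hrs : residual F B xs ls = 0) (hss : -ls ∈ subdiff G (B xs))
    (hlam : Tendsto lam atTop (𝓝 ls)) :
    Tendsto x atTop (𝓝 xs) ∧ Tendsto y atTop (𝓝 (B xs)) := by
  have hμ := hF.1
  have hσ : ∀ k, 0 < σ k := fun k => hs.trans_le (hσs k)
  have hlam1 : Tendsto (fun k => lam (k + 1)) atTop (𝓝 ls) := hlam.comp (tendsto_add_atTop_nat 1)
  have hΔ : Tendsto (fun k => ‖lam (k + 1) - lam k‖) atTop (𝓝 0) := by
    simpa using (hlam1.sub hlam).norm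
  have hd : Tendsto (fun k => ‖lam (k + 1) - ls‖) atTop (𝓝 0) :=
    tendsto_iff_norm_sub_tendsto_zero.1 hlam1
  have hbound : ∀ k, ‖x (k + 1) - xs‖ ^ 2 ≤
      (‖residual F B (x (k + 1)) (lam (k + 1))‖ / μ) ^ 2 +
        2 / μ * (1 / s * (‖lam (k + 1) - ls‖ * ‖lam (k + 1) - lam k‖)) := by
    intro k
    have h1 := (hstep k).inner_le hF hG (hσ k) hrs hss
    have h2 := neg_le_of_abs_le
      (abs_real_inner_le_norm (lam (k + 1) - ls) (lam (k + 1) - lam k))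
    set q := ‖lam (k + 1) - ls‖ * ‖lam (k + 1) - lam k‖ with hq
    set r := ‖residual F B (x (k + 1)) (lam (k + 1))‖ with hr
    set d := ‖x (k + 1) - xs‖ with hdd
    have hq0 : 0 ≤ q := by positivity
    have h3 : 1 / σ k * q ≤ 1 / s * q :=
      mul_le_mul_of_nonneg_right (one_div_le_one_div_of_le hs (hσs k)) hq0
    have h4 := mul_le_mul_of_nonneg_left h2 (one_div_nonneg.2 (hσ k).le)
    have h5 : μ * d ^ 2 ≤ r * d + 1 / s * q := by linarith
    have h6 : 0 ≤ (r / μ - d) ^ 2 := sq_nonneg _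
    have h7 := mul_le_mul_of_nonneg_left h5 (by positivity : 0 ≤ 2 / μ)
    have e1 : 2 / μ * (μ * d ^ 2) = 2 * d ^ 2 := by field_simp
    have e2 : 2 / μ * (r * d) = 2 * (r / μ * d) := by field_simp
    rw [mul_add, e1, e2] at h7
    linarith
  have hx2 : Tendsto (fun k => ‖x (k + 1) - xs‖ ^ 2) atTop (𝓝 0) := by
    refine squeeze_zero (fun k => sq_nonneg _) hbound ?_
    simpa using ((hres.div_const μ).pow 2).add
      (((hd.mul hΔ).const_mul (1 / s)).const_mul (2 / μ))
  have hx1 : Tendsto (fun k => x (k + 1)) atTop (𝓝 xs) := by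
    rw [tendsto_iff_norm_sub_tendsto_zero]
    simpa [Real.sqrt_sq (norm_nonneg _)] using hx2.sqrt
  refine ⟨(tendsto_add_atTop_iff_nat 1).1 hx1, (tendsto_add_atTop_iff_nat 1).1 ?_⟩
  have hyB : Tendsto (fun k => y (k + 1) - B (x (k + 1))) atTop (𝓝 0) := by
    rw [tendsto_zero_iff_norm_tendsto_zero]
    have hΔs : Tendsto (fun k => 1 / s * ‖lam (k + 1) - lam k‖) atTop (𝓝 0) := by
      simpa using hΔ.const_mul (1 / s)
    refine squeeze_zero (fun k => norm_nonneg _) (fun k => ?_) hΔs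
    rw [(hstep k).sub_eq (hσ k), norm_smul, Real.norm_of_nonneg (one_div_nonneg.2 (hσ k).le)]
    exact mul_le_mul_of_nonneg_right (one_div_le_one_div_of_le hs (hσs k)) (norm_nonneg _)
  simpa using hyB.add (tendsto_linearMap_comp B hx1)

end Convergence

/-! ### Separable sums -/

section Sums

theorem EReal_sum_ne_bot {ι : Type*} (s : Finset ι) {h : ι → EReal} (hb : ∀ i, h i ≠ ⊥) :
    ∑ i ∈ s, h i ≠ ⊥ := by
  classical
  induction s using Finset.induction_on with
  | empty => simp
  | insert i s hi ih =>
    rw [Finset.sum_insert hi]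
    exact EReal.add_ne_bot_iff.2 ⟨hb i, ih⟩

theorem EReal_coe_sum {ι : Type*} (s : Finset ι) (h : ι → ℝ) :
    ((∑ i ∈ s, h i : ℝ) : EReal) = ∑ i ∈ s, (h i : EReal) := by
  classical
  induction s using Finset.induction_on with
  | empty => simp
  | insert i s hi ih => rw [Finset.sum_insert hi, Finset.sum_insert hi, EReal.coe_add, ih]

theorem EReal_lt_top_of_sum_lt_top {ι : Type*} [Fintype ι] {h : ι → EReal} (hb : ∀ i, h i ≠ ⊥)
    (ht : ∑ i, h i < ⊤) (i : ι) : h i < ⊤ := by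
  classical
  by_contra hi
  rw [not_lt_top_iff] at hi
  rw [← Finset.add_sum_erase _ _ (Finset.mem_univ i), hi,
    EReal.top_add_of_ne_bot (EReal_sum_ne_bot _ hb)] at ht
  exact lt_irrefl _ ht

theorem lowerSemicontinuous_EReal_sum {X ι : Type*} [TopologicalSpace X] (s : Finset ι)
    {h : ι → X → EReal} (hb : ∀ i x, h i x ≠ ⊥) (hl : ∀ i, LowerSemicontinuous (h i)) :
    LowerSemicontinuous fun x => ∑ i ∈ s, h i x := by
  classical
  induction s using Finset.induction_on with
  | empty => simpa using lowerSemicontinuous_const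
  | insert i s hi ih =>
    simp only [Finset.sum_insert hi]
    exact (hl i).add' ih fun x => EReal.continuousAt_add
      (.inr (EReal_sum_ne_bot s fun j => hb j x)) (.inl (hb i x))

variable {m n : ℕ}

theorem mem_effDom_sumG {g : Fin m → Loc n → EReal} (hg : ∀ i, ClosedProperConvex (g i))
    {y : YSp m n} : y ∈ effDom (sumG g) ↔
      (∀ i, y (Sum.inr i) = 0) ∧ ∀ i, y (Sum.inl i) ∈ effDom (g i) := by
  constructor
  · intro h
    have h' : sumG g y < ⊤ := h
    unfold sumG at h'
    split_ifs at h' with h0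
    · exact ⟨h0, EReal_lt_top_of_sum_lt_top (fun i => (hg i).ne_bot _) h'⟩
    · exact absurd h' (lt_irrefl _)
  · rintro ⟨h0, h1⟩
    change sumG g y < ⊤
    rw [sumG, if_pos h0, Finset.sum_congr rfl fun i _ => ((hg i).coe_toReal (h1 i)).symm,
      ← EReal_coe_sum]
    exact EReal.coe_lt_top _

theorem sumG_eq_coe {g : Fin m → Loc n → EReal} (hg : ∀ i, ClosedProperConvex (g i))
    {y : YSp m n} (hy : y ∈ effDom (sumG g)) :
    sumG g y = ((∑ i, (g i (y (Sum.inl i))).toReal : ℝ) : EReal) := by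
  obtain ⟨h0, h1⟩ := (mem_effDom_sumG hg).1 hy
  rw [sumG, if_pos h0, EReal_coe_sum]
  exact Finset.sum_congr rfl fun i _ => ((hg i).coe_toReal (h1 i)).symm

theorem closedProperConvex_sumG {g : Fin m → Loc n → EReal}
    (hg : ∀ i, ClosedProperConvex (g i)) : ClosedProperConvex (sumG g) where
  ne_bot y := by
    unfold sumG
    split_ifs
    · exact EReal_sum_ne_bot _ fun i => (hg i).ne_bot _
    · exact top_ne_bot
  dom_nonempty := by
    choose z hz using fun i => (hg i).dom_nonempty
    exact ⟨WithLp.toLp 2 (Sum.elim z fun _ => 0),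
      (mem_effDom_sumG hg).2 ⟨fun i => rfl, fun i => hz i⟩⟩
  closed := by
    rw [lowerSemicontinuous_iff_isClosed_preimage]
    intro c
    rcases eq_or_ne c ⊤ with rfl | hc
    · simp
    have hcoord : ∀ s : Fin m ⊕ Fin m, Continuous fun y : YSp m n => y s := fun s =>
      (PiLp.proj (𝕜 := ℝ) 2 (fun _ : Fin m ⊕ Fin m => Loc n) s).continuous
    have hl : LowerSemicontinuous fun y : YSp m n => ∑ i, g i (y (Sum.inl i)) :=
      lowerSemicontinuous_EReal_sum _ (fun i y => (hg i).ne_bot _) fun i =>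
        (hg i).closed.comp (hcoord _)
    have : sumG g ⁻¹' Set.Iic c = (⋂ i, {y : YSp m n | y (Sum.inr i) = 0}) ∩
        (fun y : YSp m n => ∑ i, g i (y (Sum.inl i))) ⁻¹' Set.Iic c := by
      ext y
      simp only [Set.mem_preimage, Set.mem_Iic, Set.mem_inter_iff, Set.mem_iInter,
        Set.mem_ofPred_eq]
      by_cases h0 : ∀ i, y (Sum.inr i) = 0
      · rw [sumG, if_pos h0]
        exact ⟨fun h => ⟨h0, h⟩, fun h => h.2⟩
      · rw [sumG, if_neg h0]
        exact ⟨fun h => absurd (top_le_iff.1 h) hc, fun h => absurd h.1 h0⟩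
    rw [this]
    exact (isClosed_iInter fun i => isClosed_eq (hcoord _) continuous_const).inter
      (hl.isClosed_preimage c)
  convex := by
    rintro ⟨y, r⟩ hy ⟨z, t⟩ hz a b ha hb hab
    have hy' : sumG g y ≤ (r : EReal) := hy
    have hz' : sumG g z ≤ (t : EReal) := hz
    have hyd : y ∈ effDom (sumG g) := hy'.trans_lt (EReal.coe_lt_top _)
    have hzd : z ∈ effDom (sumG g) := hz'.trans_lt (EReal.coe_lt_top _)
    rw [sumG_eq_coe hg hyd, EReal.coe_le_coe_iff] at hy'
    rw [sumG_eq_coe hg hzd, EReal.coe_le_coe_iff] at hz'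
    obtain ⟨hy0, hy1⟩ := (mem_effDom_sumG hg).1 hyd
    obtain ⟨hz0, hz1⟩ := (mem_effDom_sumG hg).1 hzd
    obtain rfl : a = 1 - b := by linarith
    have hseg := fun i => (hg i).segment_le (hy1 i) (hz1 i) hb (by linarith)
    have hcomb : ∀ i, ((1 - b) • y + b • z : YSp m n) (Sum.inl i) =
        y (Sum.inl i) + b • (z (Sum.inl i) - y (Sum.inl i)) := by
      intro i
      rw [PiLp.add_apply, PiLp.smul_apply, PiLp.smul_apply]
      module
    have hd : (1 - b) • y + b • z ∈ effDom (sumG g) := by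
      refine (mem_effDom_sumG hg).2 ⟨fun i => ?_, fun i => ?_⟩
      · rw [PiLp.add_apply, PiLp.smul_apply, PiLp.smul_apply, hy0, hz0]
        simp
      · rw [hcomb]
        exact (hseg i).1
    change sumG g ((1 - b) • y + b • z) ≤ (((1 - b) * r + b * t : ℝ) : EReal)
    rw [sumG_eq_coe hg hd, EReal.coe_le_coe_iff]
    have h1 : ∑ i, (g i (((1 - b) • y + b • z : YSp m n) (Sum.inl i))).toReal ≤
        ∑ i, ((1 - b) * (g i (y (Sum.inl i))).toReal + b * (g i (z (Sum.inl i))).toReal) := by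
      refine Finset.sum_le_sum fun i _ => ?_
      rw [hcomb]
      linarith [(hseg i).2]
    rw [Finset.sum_add_distrib, ← Finset.mul_sum, ← Finset.mul_sum] at h1
    have h2 := mul_le_mul_of_nonneg_left hy' ha
    have h3 := mul_le_mul_of_nonneg_left hz' hb
    linarith

/-- The real-valued function underlying `sumF`. -/
def sumFun (f : Fin m → Loc n → ℝ) (x : XSp m n) : ℝ := ∑ i, f i (x i)

theorem hasGradientAt_sumFun {f : Fin m → Loc n → ℝ} (hf : ∀ i, Differentiable ℝ (f i))
    (x : XSp m n) :
    HasGradientAt (sumFun f) (WithLp.toLp 2 fun i => gradient (f i) (x i) : XSp m n) x := by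
  rw [hasGradientAt_iff_hasFDerivAt]
  have h : ∀ i ∈ Finset.univ, HasFDerivAt (fun x : XSp m n => f i (x i))
      ((InnerProductSpace.toDual ℝ (Loc n) (gradient (f i) (x i))).comp
        (PiLp.proj (𝕜 := ℝ) 2 (fun _ : Fin m => Loc n) i)) x := by
    intro i _
    have h1 := hasGradientAt_iff_hasFDerivAt.1 (hf i (x i)).hasGradientAt
    exact HasFDerivAt.comp x h1 (PiLp.proj (𝕜 := ℝ) 2 (fun _ : Fin m => Loc n) i).hasFDerivAt
  refine (HasFDerivAt.fun_sum h).congr_fderiv ?_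
  ext v
  simp [PiLp.inner_apply]

theorem stronglyConvex_sumFun [NeZero m] {f : Fin m → Loc n → ℝ} {μ : Fin m → ℝ}
    (hf : ∀ i, StronglyConvex (f i) (μ i)) : StronglyConvex (sumFun f) (⨅ i, μ i) := by
  refine ⟨?_, fun x => (hasGradientAt_sumFun (fun i => (hf i).2.1) x).differentiableAt,
    fun x y => ?_⟩
  · obtain ⟨i, hi⟩ := exists_eq_ciInf_of_finite (f := μ)
    rw [← hi]
    exact (hf i).1
  · rw [(hasGradientAt_sumFun (fun i => (hf i).2.1) x).gradient, PiLp.inner_apply,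
      PiLp.norm_sq_eq_of_L2, Finset.mul_sum, sumFun, ← Finset.sum_add_distrib,
      ← Finset.sum_add_distrib]
    refine Finset.sum_le_sum fun i _ => ?_
    have h1 := (hf i).2.2 (x i) (y i)
    have h2 : (⨅ i, μ i) * ‖y i - x i‖ ^ 2 ≤ μ i * ‖y i - x i‖ ^ 2 :=
      mul_le_mul_of_nonneg_right (ciInf_le (Set.finite_range μ).bddBelow i) (sq_nonneg _)
    simp only [PiLp.sub_apply]
    linarith

end Sums

/-! ### The distributed problem -/

section Distributed

variable {m n : ℕ} {f : Fin m → Loc n → ℝ} {g : Fin m → Loc n → EReal}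
  {L : Matrix (Fin m) (Fin m) ℝ} {μ : ℝ}

/-- The infimum in `phi` is attained at the proximal point, so it is a finite number and `toReal`
loses nothing. -/
theorem phi_eq_augFun (hG : ClosedProperConvex (sumG g)) {σ : ℝ} (hσ : 0 < σ) (lam : YSp m n) :
    phi f g L σ lam = augFun (sumFun f) (sumG g) (opB n L) σ lam := by
  funext x
  obtain ⟨y, hy⟩ := hG.exists_isProx hσ (opB n L x - (1 / σ) • lam)
  have e : ∀ z ∈ effDom (sumG g), augLag f g L σ lam x z = ((sumFun f x + (sumG g z).toReal +
      (σ / 2 * ‖z - (opB n L x - (1 / σ) • lam)‖ ^ 2 - 1 / (2 * σ) * ‖lam‖ ^ 2) : ℝ) : EReal) := by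
    intro z hz
    have e1 : opB n L x - z - (1 / σ) • lam = -(z - (opB n L x - (1 / σ) • lam)) := by abel
    rw [augLag, e1, norm_neg, EReal.coe_add, EReal.coe_add, hG.coe_toReal hz]
    rfl
  have h : ⨅ z, augLag f g L σ lam x z =
      ((augFun (sumFun f) (sumG g) (opB n L) σ lam x : ℝ) : EReal) := by
    have e2 : augLag f g L σ lam x y =
        ((augFun (sumFun f) (sumG g) (opB n L) σ lam x : ℝ) : EReal) := by
      rw [e y hy.1, augFun, hy.moreauEnv_eq]
      congr 1
      ring
    refine le_antisymm ((iInf_le _ y).trans e2.le) (le_iInf fun z => ?_)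
    by_cases hz : z ∈ effDom (sumG g)
    · rw [← e2, e z hz, e y hy.1, EReal.coe_le_coe_iff]
      linarith [hy.2 z hz]
    · rw [augLag, eq_top_of_notMem_effDom hz, sumF, EReal.coe_add_top, EReal.top_add_coe]
      exact le_top
  rw [phi, h, EReal.toReal_coe]

theorem IsALM.multiplierStep (hG : ClosedProperConvex (sumG g)) {σ : ℕ → ℝ} (hσ : ∀ k, 0 < σ k)
    {x : ℕ → XSp m n} {y lam : ℕ → YSp m n} (h : IsALM f g L σ x y lam) (k : ℕ) :
    MultiplierStep (sumG g) (opB n L) (σ k) (lam k) (x (k + 1)) (y (k + 1)) (lam (k + 1)) := by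
  rw [h.step_lam k]
  exact (isProx_of_mem_proxSet hG (hσ k) (h.step_y k)).multiplierStep hG (hσ k)

/-- The gradients in the stopping criteria are the stationarity residuals of the iterates. -/
theorem IsALM.gradient_phi (hF : StronglyConvex (sumFun f) μ) (hG : ClosedProperConvex (sumG g))
    {σ : ℕ → ℝ} (hσ : ∀ k, 0 < σ k) {x : ℕ → XSp m n} {y lam : ℕ → YSp m n}
    (h : IsALM f g L σ x y lam) (k : ℕ) :
    gradient (phi f g L (σ k) (lam k)) (x (k + 1)) =
      residual (sumFun f) (opB n L) (x (k + 1)) (lam (k + 1)) := by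
  rw [phi_eq_augFun hG (hσ k), h.step_lam k]
  exact ((isProx_of_mem_proxSet hG (hσ k) (h.step_y k)).hasGradientAt_augFun hF hG (hσ k)).gradient

theorem sumF_add_sumG_eq (hG : ClosedProperConvex (sumG g)) (x : XSp m n) {y : YSp m n}
    (hy : y ∈ effDom (sumG g)) :
    sumF f x + sumG g y = ((sumFun f x + (sumG g y).toReal : ℝ) : EReal) := by
  rw [EReal.coe_add, hG.coe_toReal hy]
  rfl

theorem sumF_add_sumG_eq_top (x : XSp m n) {y : YSp m n} (hy : y ∉ effDom (sumG g)) :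
    sumF f x + sumG g y = ⊤ := by
  rw [eq_top_of_notMem_effDom hy, sumF, EReal.coe_add_top]

theorem isOptimal_of_residual (hF : StronglyConvex (sumFun f) μ)
    (hG : ClosedProperConvex (sumG g)) {xs : XSp m n} {ls : YSp m n}
    (hr : residual (sumFun f) (opB n L) xs ls = 0) (hs : -ls ∈ subdiff (sumG g) (opB n L xs)) :
    IsOptimal f g L xs (opB n L xs) := by
  have hd := (hG.mem_subdiff_iff.1 hs).1
  refine ⟨rfl, ?_, ?_⟩
  · rw [sumF_add_sumG_eq hG xs hd]
    exact EReal.coe_lt_top _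
  · rintro x _ rfl
    by_cases hx : opB n L x ∈ effDom (sumG g)
    · rw [sumF_add_sumG_eq hG xs hd, sumF_add_sumG_eq hG x hx, EReal.coe_le_coe_iff]
      have h1 := primal_growth hF hG hr hs hx
      have h2 : 0 ≤ 1 / 2 * μ * ‖x - xs‖ ^ 2 := by have := hF.1; positivity
      linarith
    · rw [sumF_add_sumG_eq_top x hx]
      exact le_top

theorem IsOptimal.mem_effDom {x : XSp m n} {y : YSp m n} (h : IsOptimal f g L x y) :
    y ∈ effDom (sumG g) := by
  by_contra hy
  have := h.2.1
  rw [sumF_add_sumG_eq_top x hy] at this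
  exact lt_irrefl _ this

theorem IsOptimal.eq_of_residual (hF : StronglyConvex (sumFun f) μ)
    (hG : ClosedProperConvex (sumG g)) {xs : XSp m n} {ls : YSp m n}
    (hr : residual (sumFun f) (opB n L) xs ls = 0) (hs : -ls ∈ subdiff (sumG g) (opB n L xs))
    {x : XSp m n} {y : YSp m n} (h : IsOptimal f g L x y) : x = xs ∧ y = opB n L xs := by
  have hd := (hG.mem_subdiff_iff.1 hs).1
  have hy := h.mem_effDom
  have h1 := h.2.2 xs _ rfl
  obtain rfl := h.1
  rw [sumF_add_sumG_eq hG xs hd, sumF_add_sumG_eq hG x hy, EReal.coe_le_coe_iff] at h1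
  have h2 := primal_growth hF hG hr hs hy
  have h3 : μ * ‖x - xs‖ ^ 2 ≤ 0 := by linarith
  have h4 : ‖x - xs‖ = 0 :=
    sq_eq_zero_iff.1 (le_antisymm (nonpos_of_mul_nonpos_right h3 hF.1) (sq_nonneg _))
  have h5 : x = xs := sub_eq_zero.1 (norm_eq_zero.1 h4)
  exact ⟨h5, by rw [h5]⟩

/-! ### The Lagrangian operator -/

theorem lagrangian_eq (hG : ClosedProperConvex (sumG g)) (q : PSp m n) (lam : YSp m n)
    (hq : q.snd ∈ effDom (sumG g)) :
    lagrangian f g L q lam = ((sumFun f q.fst + (sumG g q.snd).toReal -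
      inner ℝ lam (opB n L q.fst - q.snd) : ℝ) : EReal) := by
  rw [lagrangian, sumF_add_sumG_eq hG _ hq, EReal.coe_sub]

theorem lagrangian_eq_top (q : PSp m n) (lam : YSp m n) (hq : q.snd ∉ effDom (sumG g)) :
    lagrangian f g L q lam = ⊤ := by
  rw [lagrangian, sumF_add_sumG_eq_top _ hq, EReal.top_sub_coe]

/-- The iterates come with an explicit element of `T_l`, made of the stationarity residual and the
infeasibility; the component that belongs to `y` is zero. -/
theorem residual_mem_opTl (hF : StronglyConvex (sumFun f) μ) (hG : ClosedProperConvex (sumG g))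
    {x : XSp m n} {y lam : YSp m n} (h : -lam ∈ subdiff (sumG g) y) :
    (WithLp.toLp 2 (WithLp.toLp 2 (residual (sumFun f) (opB n L) x lam, 0), opB n L x - y) :
      ZSp m n) ∈ opTl f g L (WithLp.toLp 2 (WithLp.toLp 2 (x, y), lam)) := by
  obtain ⟨hy, hsub⟩ := hG.mem_subdiff_iff.1 h
  refine ⟨fun q => ?_, fun ν => ?_⟩
  · by_cases hq : q.snd ∈ effDom (sumG g)
    · change lagrangian f g L (WithLp.toLp 2 (x, y)) lam +
        ((inner ℝ (WithLp.toLp 2 (residual (sumFun f) (opB n L) x lam, 0) : PSp m n)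
          (q - WithLp.toLp 2 (x, y)) : ℝ) : EReal) ≤ lagrangian f g L q lam
      rw [lagrangian_eq hG (WithLp.toLp 2 (x, y)) lam hy, lagrangian_eq hG _ _ hq,
        ← EReal.coe_add, EReal.coe_le_coe_iff,
        WithLp.prod_inner_apply]
      have h1 := hF.2.2 x q.fst
      have h2 := hsub _ hq
      have h3 : 0 ≤ 1 / 2 * μ * ‖q.fst - x‖ ^ 2 := by have := hF.1; positivity
      have e : opB n L q.fst - q.snd = opB n L (q.fst - x) + (opB n L x - y) - (q.snd - y) := by
        rw [map_sub]; abel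
      rw [inner_neg_left] at h2
      simp only [residual, inner_zero_left, add_zero]
      rw [e, inner_sub_right lam (_ + _), inner_add_right, ← LinearMap.adjoint_inner_left,
        inner_sub_left]
      change sumFun f x + (sumG g y).toReal - inner ℝ lam (opB n L x - y) +
        (inner ℝ (gradient (sumFun f) x) (q.fst - x) -
          inner ℝ (LinearMap.adjoint (opB n L) lam) (q.fst - x)) ≤ _
      linarith
    · simp only
      rw [lagrangian_eq_top _ _ hq]
      exact le_top
  · change lagrangian f g L (WithLp.toLp 2 (x, y)) ν ≤ lagrangian f g L (WithLp.toLp 2 (x, y)) lam +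
      ((inner ℝ (-(opB n L x - y)) (ν - lam) : ℝ) : EReal)
    rw [lagrangian_eq hG (WithLp.toLp 2 (x, y)) ν hy,
      lagrangian_eq hG (WithLp.toLp 2 (x, y)) lam hy,
      ← EReal.coe_add, EReal.coe_le_coe_iff, inner_neg_left,
      inner_sub_right (opB n L x - y), real_inner_comm ν, real_inner_comm lam]
    change sumFun f x + (sumG g y).toReal - inner ℝ ν (opB n L x - y) ≤
      sumFun f x + (sumG g y).toReal - inner ℝ lam (opB n L x - y) +
        -(inner ℝ ν (opB n L x - y) - inner ℝ lam (opB n L x - y))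
    linarith

/-- A zero of `T_l` is a saddle point of the Lagrangian. Properness of `G` rules out the value `+∞`
there. -/
theorem isOptimal_of_zero_mem_opTl (hG : ClosedProperConvex (sumG g)) {z : ZSp m n}
    (h : (0 : ZSp m n) ∈ opTl f g L z) : IsOptimal f g L z.fst.fst z.fst.snd := by
  obtain ⟨h1, h2⟩ := h
  have h1' : ∀ q, lagrangian f g L z.fst z.snd ≤ lagrangian f g L q z.snd := by
    intro q
    have := h1 q
    simpa using this
  have h2' : ∀ ν, lagrangian f g L z.fst ν ≤ lagrangian f g L z.fst z.snd := by
    intro ν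
    have := h2 ν
    simpa using this
  have hd : z.fst.snd ∈ effDom (sumG g) := by
    by_contra hd
    obtain ⟨y₀, hy₀⟩ := hG.dom_nonempty
    have h3 := h1' (WithLp.toLp 2 (z.fst.fst, y₀))
    rw [lagrangian_eq_top _ _ hd, lagrangian_eq hG (WithLp.toLp 2 (z.fst.fst, y₀)) _ hy₀] at h3
    exact EReal.coe_ne_top _ (top_le_iff.1 h3)
  -- maximality in `lam` forces feasibility
  have hfeas : opB n L z.fst.fst = z.fst.snd := by
    have h3 := h2' (z.snd - (opB n L z.fst.fst - z.fst.snd))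
    rw [lagrangian_eq hG _ _ hd, lagrangian_eq hG _ _ hd, EReal.coe_le_coe_iff, inner_sub_left,
      real_inner_self_eq_norm_sq] at h3
    have h4 : ‖opB n L z.fst.fst - z.fst.snd‖ = 0 :=
      sq_eq_zero_iff.1 (le_antisymm (by linarith) (sq_nonneg _))
    exact sub_eq_zero.1 (norm_eq_zero.1 h4)
  refine ⟨hfeas, ?_, ?_⟩
  · rw [sumF_add_sumG_eq hG _ hd]
    exact EReal.coe_lt_top _
  · intro x' y' hxy
    have h3 := h1' (WithLp.toLp 2 (x', y'))
    simpa [lagrangian, hfeas, hxy] using h3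

theorem fst_eq_of_mem_invImage_opTl (hF : StronglyConvex (sumFun f) μ)
    (hG : ClosedProperConvex (sumG g)) {xs : XSp m n} {ls : YSp m n}
    (hr : residual (sumFun f) (opB n L) xs ls = 0) (hs : -ls ∈ subdiff (sumG g) (opB n L xs))
    {z : ZSp m n} (hz : z ∈ invImage (opTl f g L) 0) :
    z.fst = WithLp.toLp 2 (xs, opB n L xs) := by
  have hz' : (0 : ZSp m n) ∈ opTl f g L z := hz
  obtain ⟨h1, h2⟩ := (isOptimal_of_zero_mem_opTl hG hz').eq_of_residual hF hG hr hs
  rw [← h2, ← h1]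
  rfl

end Distributed

/-! ### Limits of the rates -/

theorem exists_pos_le_of_tendsto {σ : ℕ → ℝ} (hσ : ∀ k, 0 < σ k) {σinf : EReal}
    (hσinf : 0 < σinf) (hlim : Tendsto (fun k => (σ k : EReal)) atTop (𝓝 σinf)) :
    ∃ s > 0, ∀ k, s ≤ σ k := by
  obtain ⟨t, ht0, ht⟩ := EReal.lt_iff_exists_real_btwn.1 hσinf
  obtain ⟨N, hN⟩ := eventually_atTop.1 (hlim.eventually (eventually_gt_nhds ht))
  have hfin : ∃ s > 0, ∀ k < N, s ≤ σ k := by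
    clear hN
    induction N with
    | zero => exact ⟨1, one_pos, fun k hk => absurd hk (Nat.not_lt_zero k)⟩
    | succ N ih =>
      obtain ⟨s, hs, h⟩ := ih
      refine ⟨min s (σ N), lt_min hs (hσ N), fun k hk => ?_⟩
      rcases Nat.lt_succ_iff_lt_or_eq.1 hk with hk | rfl
      · exact (min_le_left _ _).trans (h k hk)
      · exact min_le_right _ _
  obtain ⟨s, hs, h⟩ := hfin
  refine ⟨min s t, lt_min hs (by exact_mod_cast ht0), fun k => ?_⟩
  rcases lt_or_ge k N with hk | hk
  · exact (min_le_left _ _).trans (h k hk)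
  · exact (min_le_right _ _).trans (le_of_lt (by exact_mod_cast hN k hk))

/-- The limit `σ_∞` is either `+∞` or a positive real number. -/
theorem tendsto_atTop_or_tendsto_real {σ : ℕ → ℝ} {σinf : EReal}
    (hσinf : 0 < σinf) (hlim : Tendsto (fun k => (σ k : EReal)) atTop (𝓝 σinf)) :
    (σinf = ⊤ ∧ Tendsto σ atTop atTop) ∨
      ∃ s : ℝ, 0 < s ∧ σinf = (s : EReal) ∧ Tendsto σ atTop (𝓝 s) := by
  induction σinf with
  | bot => exact absurd hσinf not_lt_bot
  | top => exact .inl ⟨rfl, EReal.tendsto_coe_nhds_top_iff.1 hlim⟩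
  | coe s => exact .inr ⟨s, by exact_mod_cast hσinf, rfl, EReal.tendsto_coe.1 hlim⟩

theorem tendsto_theta {a : ℝ} {σ δ : ℕ → ℝ} {σinf : EReal} (hσinf : 0 < σinf)
    (hlim : Tendsto (fun k => (σ k : EReal)) atTop (𝓝 σinf)) (hδ : Tendsto δ atTop (𝓝 0)) :
    Tendsto (fun k => theta a (σ k) (δ k)) atTop (𝓝 (thetaInf a σinf)) := by
  have key : Tendsto (fun k => a / √(a ^ 2 + σ k ^ 2)) atTop (𝓝 (thetaInf a σinf)) := by
    rcases tendsto_atTop_or_tendsto_real hσinf hlim with ⟨rfl, h⟩ | ⟨s, hs, rfl, h⟩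
    · rw [thetaInf, if_pos rfl]
      refine tendsto_const_nhds.div_atTop (tendsto_atTop_mono (fun k => ?_) h)
      exact Real.le_sqrt_of_sq_le (by linarith [sq_nonneg a])
    · rw [thetaInf, if_neg (EReal.coe_ne_top s), EReal.toReal_coe]
      refine tendsto_const_nhds.div ((tendsto_const_nhds.add (h.pow 2)).sqrt) ?_
      exact (Real.sqrt_pos.2 (by positivity)).ne'
  have h1 := (key.add (hδ.const_mul 2)).div (tendsto_const_nhds.sub hδ)
    (by norm_num : (1 : ℝ) - 0 ≠ 0)
  rw [add_comm, mul_zero, sub_zero, div_one, zero_add] at h1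
  exact h1

theorem thetaInf_lt_one (a : ℝ) {σinf : EReal} (hσinf : 0 < σinf) : thetaInf a σinf < 1 := by
  induction σinf with
  | bot => exact absurd hσinf not_lt_bot
  | top => rw [thetaInf, if_pos rfl]; exact one_pos
  | coe s =>
    have hs : 0 < s := by exact_mod_cast hσinf
    rw [thetaInf, if_neg (EReal.coe_ne_top s), EReal.toReal_coe,
      div_lt_one (Real.sqrt_pos.2 (by positivity))]
    exact Real.lt_sqrt_of_sq_lt (by linarith [sq_pos_of_pos hs])

theorem tendsto_ratio {a : ℝ} {σ δ : ℕ → ℝ} {σinf : EReal} (hσinf : 0 < σinf)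
    (hlim : Tendsto (fun k => (σ k : EReal)) atTop (𝓝 σinf)) (hδ : Tendsto δ atTop (𝓝 0)) :
    Tendsto (fun k => a * (1 + δ k) / σ k) atTop (𝓝 (ratioInf a σinf)) := by
  have h1 : Tendsto (fun k => a * (1 + δ k)) atTop (𝓝 a) := by
    simpa using (hδ.const_add 1).const_mul a
  rcases tendsto_atTop_or_tendsto_real hσinf hlim with ⟨rfl, h⟩ | ⟨s, hs, rfl, h⟩
  · rw [ratioInf, if_pos rfl]
    exact h1.div_atTop h
  · rw [ratioInf, if_neg (EReal.coe_ne_top s), EReal.toReal_coe]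
    exact h1.div h hs.ne'

/-! ### The primal rate -/

section PrimalRate

variable {m n : ℕ} {f : Fin m → Loc n → ℝ} {g : Fin m → Loc n → EReal}
  {L : Matrix (Fin m) (Fin m) ℝ} {μ : ℝ}

theorem norm_toLp_prod_le {P D : Type*} [NormedAddCommGroup P] [NormedAddCommGroup D]
    (p : P) (d : D) : ‖(WithLp.toLp 2 (p, d) : WithLp 2 (P × D))‖ ≤ ‖p‖ + ‖d‖ := by
  refine (abs_le_of_sq_le_sq' ?_ (by positivity)).2
  rw [WithLp.prod_norm_sq_eq_of_L2, add_sq]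
  have := mul_nonneg (norm_nonneg p) (norm_nonneg d)
  change ‖p‖ ^ 2 + ‖d‖ ^ 2 ≤ _
  linarith

theorem norm_fst_le {P D : Type*} [NormedAddCommGroup P] [NormedAddCommGroup D]
    (z : WithLp 2 (P × D)) : ‖z.fst‖ ≤ ‖z‖ := by
  refine (abs_le_of_sq_le_sq' ?_ (norm_nonneg _)).2
  rw [WithLp.prod_norm_sq_eq_of_L2]
  linarith [sq_nonneg ‖z.snd‖]

theorem norm_fst_sub_le_infDist {P D : Type*} [NormedAddCommGroup P] [NormedAddCommGroup D]
    {S : Set (WithLp 2 (P × D))} (hS : S.Nonempty) {p : P} (hp : ∀ z ∈ S, z.fst = p)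
    (u : WithLp 2 (P × D)) : ‖u.fst - p‖ ≤ Metric.infDist u S := by
  refine (Metric.le_infDist hS).2 fun z hz => ?_
  rw [dist_eq_norm, ← hp z hz]
  exact norm_fst_le (u - z)

/-- Metric subregularity of `T_l`, applied to the element of `T_l` made of the residual and the
infeasibility of the iterates, bounds the distance to the only primal solution. -/
theorem eventually_norm_primal_le (hF : StronglyConvex (sumFun f) μ)
    (hG : ClosedProperConvex (sumG g)) {σ δ' : ℕ → ℝ} {x : ℕ → XSp m n} {y lam : ℕ → YSp m n}
    (hσ : ∀ k, 0 < σ k)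
    (hstep : ∀ k, MultiplierStep (sumG g) (opB n L) (σ k) (lam k) (x (k + 1)) (y (k + 1))
      (lam (k + 1)))
    {xs : XSp m n} {ls : YSp m n} (hr : residual (sumFun f) (opB n L) xs ls = 0)
    (hs : -ls ∈ subdiff (sumG g) (opB n L xs))
    (hx : Tendsto x atTop (𝓝 xs)) (hy : Tendsto y atTop (𝓝 (opB n L xs)))
    (hlam : Tendsto lam atTop (𝓝 ls))
    (hres : Tendsto (fun k => ‖residual (sumFun f) (opB n L) (x (k + 1)) (lam (k + 1))‖) atTop
      (𝓝 0))
    {a : ℝ} (hMS : MetricallySubregular (opTl f g L)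
      (WithLp.toLp 2 (WithLp.toLp 2 (xs, opB n L xs), ls)) 0 a)
    (hC : ∀ k, ‖residual (sumFun f) (opB n L) (x (k + 1)) (lam (k + 1))‖ ≤
      δ' k / σ k * ‖lam (k + 1) - lam k‖) :
    ∀ᶠ k in atTop,
      ‖(WithLp.toLp 2 (x (k + 1) - xs, y (k + 1) - opB n L xs) : PSp m n)‖ ≤
        a * (1 + δ' k) / σ k * ‖lam (k + 1) - lam k‖ := by
  obtain ⟨ha, h0, U, hU, V, hV, h⟩ := hMS
  have hx1 := hx.comp (tendsto_add_atTop_nat 1)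
  have hy1 := hy.comp (tendsto_add_atTop_nat 1)
  have hl1 := hlam.comp (tendsto_add_atTop_nat 1)
  have hz : Tendsto (fun k => (WithLp.toLp 2 (WithLp.toLp 2 (x (k + 1), y (k + 1)), lam (k + 1)) :
      ZSp m n)) atTop (𝓝 (WithLp.toLp 2 (WithLp.toLp 2 (xs, opB n L xs), ls))) :=
    ((WithLp.prod_continuous_toLp 2 _ _).tendsto _).comp
      ((((WithLp.prod_continuous_toLp 2 _ _).tendsto _).comp (hx1.prodMk_nhds hy1)).prodMk_nhds
        hl1)
  set w : ℕ → ZSp m n := fun k => WithLp.toLp 2 (WithLp.toLp 2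
    (residual (sumFun f) (opB n L) (x (k + 1)) (lam (k + 1)), 0),
    opB n L (x (k + 1)) - y (k + 1)) with hw
  have hwle : ∀ k, ‖w k‖ ≤ ‖residual (sumFun f) (opB n L) (x (k + 1)) (lam (k + 1))‖ +
      ‖opB n L (x (k + 1)) - y (k + 1)‖ := by
    intro k
    refine (norm_toLp_prod_le _ _).trans (add_le_add_left ?_ _)
    simpa only [norm_zero, add_zero] using norm_toLp_prod_le
      (residual (sumFun f) (opB n L) (x (k + 1)) (lam (k + 1))) (0 : YSp m n)
  have hw0 : Tendsto w atTop (𝓝 0) := by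
    rw [tendsto_zero_iff_norm_tendsto_zero]
    refine squeeze_zero (fun k => norm_nonneg _) hwle ?_
    have hBx := tendsto_linearMap_comp (opB n L) hx1
    simpa using hres.add (hBx.sub hy1).norm
  filter_upwards [hz.eventually hU, hw0.eventually hV] with k hkU hkV
  have hmem := residual_mem_opTl (L := L) (x := x (k + 1)) hF hG (hstep k).neg_mem
  have h1 := h _ hkU ⟨w k, hmem, hkV⟩
  have h2 : Metric.infDist 0 (opTl f g L (WithLp.toLp 2 (WithLp.toLp 2
      (x (k + 1), y (k + 1)), lam (k + 1))) ∩ V) ≤ ‖w k‖ := by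
    rw [← dist_zero_left]
    exact Metric.infDist_le_dist_of_mem ⟨hmem, hkV⟩
  have h3 : ‖w k‖ ≤ (1 + δ' k) / σ k * ‖lam (k + 1) - lam k‖ := by
    refine (hwle k).trans ?_
    rw [norm_sub_rev, (hstep k).sub_eq (hσ k), norm_smul,
      Real.norm_of_nonneg (one_div_nonneg.2 (hσ k).le)]
    refine (add_le_add_left (hC k) _).trans (le_of_eq ?_)
    ring
  have h4 : ‖(WithLp.toLp 2 (x (k + 1) - xs, y (k + 1) - opB n L xs) : PSp m n)‖ ≤
      Metric.infDist (WithLp.toLp 2 (WithLp.toLp 2 (x (k + 1), y (k + 1)), lam (k + 1)) : ZSp m n)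
        (invImage (opTl f g L) 0) := by
    have hne : (invImage (opTl f g L) 0).Nonempty := ⟨_, h0⟩
    exact norm_fst_sub_le_infDist hne
      (fun z hz => fst_eq_of_mem_invImage_opTl hF hG hr hs hz)
      (WithLp.toLp 2 (WithLp.toLp 2 (x (k + 1), y (k + 1)), lam (k + 1)))
  refine h4.trans (h1.trans ((mul_le_mul_of_nonneg_left (h2.trans h3) ha).trans (le_of_eq ?_)))
  ring

end PrimalRate

end DistALM

theorem mainTheorem2 {m n : ℕ}
    -- the connected communication graph and its gossip matrix
    (Gr : SimpleGraph (Fin m)) (hGr : Gr.Connected)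
    (L : Matrix (Fin m) (Fin m) ℝ) (hL : IsGossip Gr L)
    -- the local functions
    (f : Fin m → Loc n → ℝ) (μ ν : Fin m → ℝ)
    (hf_sc : ∀ i, StronglyConvex (f i) (μ i)) (hf_sm : ∀ i, LSmooth (f i) (ν i))
    (g : Fin m → Loc n → EReal) (hg : ∀ i, ClosedProperConvex (g i))
    (hsol : ∃ x y, IsOptimal f g L x y)
    (aH : ℝ) (hTH : ErrorBound (opTH f g L) 0 aH)
    -- the penalty parameters, with limit in `(0, +∞]`
    (σ : ℕ → ℝ) (hσ : ∀ k, 0 < σ k) (σinf : EReal) (hσinf : 0 < σinf)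
    (hσlim : Tendsto (fun k => (σ k : EReal)) atTop (𝓝 σinf))
    -- the sequence generated by the method with criteria (A′) and (B′)
    (x : ℕ → XSp m n) (y lam : ℕ → YSp m n) (hALM : IsALM f g L σ x y lam)
    (ε δ : ℕ → ℝ)
    (hA : CritA f g L (⨅ i, μ i) σ x lam ε) (hB : CritB f g L (⨅ i, μ i) σ x lam δ) :
    ∃ (xs : XSp m n) (ys lams : YSp m n),
      lams ∈ dualSol f g L ∧ Tendsto lam atTop (𝓝 lams) ∧
      (∀ᶠ k in atTop, Metric.infDist (lam (k + 1)) (dualSol f g L) ≤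
        theta aH (σ k) (δ k) * Metric.infDist (lam k) (dualSol f g L)) ∧
      Tendsto (fun k => theta aH (σ k) (δ k)) atTop (𝓝 (thetaInf aH σinf)) ∧
      thetaInf aH σinf < 1 ∧
      IsOptimal f g L xs ys ∧ (∀ x' y', IsOptimal f g L x' y' → x' = xs ∧ y' = ys) ∧
      xs ∈ interior (effDom (sumF f)) ∧ ys ∈ effDom (sumG g) ∧
      Tendsto x atTop (𝓝 xs) ∧ Tendsto y atTop (𝓝 ys) ∧
      ∀ (al : ℝ) (δ' : ℕ → ℝ),
        MetricallySubregular (opTl f g L)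
          (WithLp.toLp 2 (WithLp.toLp 2 (xs, ys), lams)) 0 al →
        CritC f g L σ x lam δ' →
        (∀ᶠ k in atTop,
          ‖(WithLp.toLp 2 (x (k + 1) - xs, y (k + 1) - ys) : PSp m n)‖ ≤
            al * (1 + δ' k) / σ k * ‖lam (k + 1) - lam k‖) ∧
        Tendsto (fun k => al * (1 + δ' k) / σ k) atTop (𝓝 (ratioInf al σinf)) := by
  have : Nonempty (Fin m) := hGr.nonempty
  have : NeZero m := ⟨Fin.pos_iff_nonempty.2 this |>.ne'⟩
  have hF := stronglyConvex_sumFun hf_sc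
  have hG := closedProperConvex_sumG hg
  obtain ⟨s, hs, hσs⟩ := exists_pos_le_of_tendsto hσ hσinf hσlim
  have hstep := hALM.multiplierStep hG hσ
  obtain ⟨hε, hεs, hA⟩ := hA
  obtain ⟨hδ, hδs, hB⟩ := hB
  simp only [hALM.gradient_phi hF hG hσ] at hA hB
  have hδ0 := hδs.tendsto_atTop_zero
  obtain ⟨⟨ls, hls, hlam⟩, hrate⟩ :=
    tendsto_dual hF hG hTH hs hσs hstep hε hεs hA hδ hδ0 hB
  obtain ⟨xs, hr, hsub⟩ := exists_of_mem_dualMinimizers hF hG hls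
  have hres := tendsto_residual hF.1 hs hσs hεs.tendsto_atTop_zero hA
  obtain ⟨hx, hy⟩ := tendsto_primal hF hG hs hσs hstep hres hr hsub hlam
  have hopt := isOptimal_of_residual hF hG hr hsub
  refine ⟨xs, opB n L xs, ls, hls, hlam, hrate, tendsto_theta hσinf hσlim hδ0,
    thetaInf_lt_one aH hσinf, hopt, fun x' y' h => h.eq_of_residual hF hG hr hsub, ?_,
    hopt.mem_effDom, hx, hy, ?_⟩
  · have : effDom (sumF f) = Set.univ := Set.eq_univ_of_forall fun z => EReal.coe_lt_top _
    rw [this, interior_univ]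
    exact Set.mem_univ _
  · rintro al δ' hMS ⟨-, hδ'0, hC⟩
    simp only [hALM.gradient_phi hF hG hσ] at hC
    exact ⟨eventually_norm_primal_le hF hG hσ hstep hr hsub hx hy hlam hres hMS hC,
      tendsto_ratio hσinf hσlim hδ'0⟩
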